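/- Let $N$ be an infinitely generated free nilpotent group of nilpotency class $c \ge 3$, that is, $N \cong F/\gamma_{c+1}(F)$ for a free group $F$ of infinite rank; here $\gamma_1(G)=G$ and $\gamma_{k+1}(G)=[\gamma_k(G),G]$ are the terms of the lower central series of a group $G$. Write $N_k=\gamma_k(N)$ and $\widehat N = N/N_c$, which is a free nilpotent group of class $c-1$. An element of a free nilpotent group is called \emph{primitive} if it belongs to some basis (set of free generators) of the group. Conjugation by $a$ is the automorphism $z \mapsto aza^{-1}$, and $\operatorname{Inn} N \le \operatorname{Aut} N$ is the group of all conjugations of $N$. Let $\sigma \mapsto \widehat\sigma$ be the homomorphism $\operatorname{Aut} N \to \operatorname{Aut} \widehat N$ determined by the natural homomorphism $N \to \widehat N$, and let $\mathrm{IA}_{c-1}(N)$ be its kernel. For $\sigma \in \operatorname{Aut} N$ let $\mathrm{NC}(\sigma)$ be the normal closure of $\sigma$ in $\operatorname{Aut} N$. Then an automorphism $\sigma$ of $N$ is conjugation by a primitive element of $N$ if and only if both of the following conditions hold: (a) $\widehat\sigma$ is conjugation by a primitive element of $\widehat N$; (b) $\mathrm{NC}(\sigma)$ contains no elements of the set $\mathrm{IA}_{c-1}(N)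 \setminus \gamma_{c-1}(\operatorname{Inn} N)$. -/

import Mathlib

section FreeNilpotentGroups

/-- The `k`-th term `γ_k(S)` of the lower central series of a subgroup `S` of a group, with the
indexing `γ_1(S) = S`, `γ_{k+1}(S) = [γ_k(S), S]` (Mathlib's series starts at index `0`).
It is used for `k ≥ 1` only. The series of the group `G` itself is the one of `S = ⊤`. -/
def gammaTerm {G : Type*} [Group G] (S : Subgroup G) (k : ℕ) : Subgroup G :=
  S.lowerCentralSeries (k - 1)

instance gammaTerm_characteristic {G : Type*} [Group G] (S : Subgroup G) [S.Characteristic]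
    (k : ℕ) : (gammaTerm S k).Characteristic :=
  inferInstanceAs (S.lowerCentralSeries (k - 1)).Characteristic

/-- `X ⊆ G` is a basis (a set of free generators) of `G` as a free nilpotent group of class `c`:
the homomorphism `F(X) → G` that extends the inclusion of `X` is onto with kernel
`γ_{c+1}(F(X))`, that is, it identifies `G` with `F(X) / γ_{c+1}(F(X))`. -/
def IsFreeNilpotentBasis (c : ℕ) {G : Type*} [Group G] (X : Set G) : Prop :=
  Function.Surjective (FreeGroup.lift (fun x : X => (x : G))) ∧
    (FreeGroup.lift (fun x : X => (x : G))).ker = gammaTerm (⊤ : Subgroup (FreeGroup X)) (c + 1)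

/-- `G` is a free nilpotent group of nilpotency class `c`. -/
def IsFreeNilpotent (c : ℕ) (G : Type*) [Group G] : Prop :=
  ∃ X : Set G, IsFreeNilpotentBasis c X

/-- A primitive element of a free nilpotent group of class `c`: a member of some basis. -/
def IsPrimitiveElement (c : ℕ) {G : Type*} [Group G] (x : G) : Prop :=
  ∃ X : Set G, IsFreeNilpotentBasis c X ∧ x ∈ X

/-- The homomorphism `Aut G → Aut (G / H)` determined by the natural homomorphism `G → G / H`,
for a characteristic subgroup `H` of `G`. -/
def autQuotient {G : Type*} [Group G] (H : Subgroup G) [H.Characteristic] :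
    MulAut G →* MulAut (G ⧸ H) where
  toFun σ := QuotientGroup.congr H H σ
    (Subgroup.characteristic_iff_map_eq.mp inferInstance σ)
  map_one' := by
    ext q
    induction q using QuotientGroup.induction_on with
    | H g => rfl
  map_mul' σ τ := by
    ext q
    induction q using QuotientGroup.induction_on with
    | H g => rfl

/-- `IA_k(G)`, the kernel of the homomorphism `Aut G → Aut (G / γ_{k+1}(G))`. -/
def IASubgroup (G : Type*) [Group G] (k : ℕ) : Subgroup (MulAut G) :=
  (autQuotient (gammaTerm (⊤ : Subgroup G) (k + 1))).ker

/-- `Inn G`, the subgroup of `Aut G` of all conjugations `z ↦ a z a⁻¹`. -/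
def innSubgroup (G : Type*) [Group G] : Subgroup (MulAut G) :=
  (MulAut.conj : G →* MulAut G).range

end FreeNilpotentGroups

/-!
Indices follow `lcs`: the last nontrivial term of the series of `N`, of class `k + 2` with `k ≥ 1`,
is `lcs N (k + 1)`, and it is central.

If `σ` is conjugation by a primitive element, its normal closure consists of conjugations. A
conjugation by `a` that is trivial modulo `lcs N (k + 1)` has `[a, z] ∈ lcs N (k + 1)` for all `z`,
and this forces `a ∈ lcs N k` (`IsFreeNilpotentFamily.mem_lcs_of_forall_commutator`).

Conversely, a basis of the quotient lifts to a basis `v` of `N`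
(`IsFreeNilpotentFamily.of_quotient`), so `σ g = x g x⁻¹ f(g)` where `x = v x₀` is a basis element
and `f` is a homomorphism to the center with values in `lcs N (k + 1)` (`IsTwist`). If `α` is an
automorphism that fixes `x`, then `α σ α⁻¹ σ⁻¹` lies in the normal closure of `σ` and is trivial
modulo `lcs N (k + 1)`; by the hypothesis on the normal closure, `α f α⁻¹ - f`, written additively,
is of the form `[a, ·]` with `a ∈ lcs N k`. That `σ` is a conjugation follows in four steps.

* As the rank is infinite, a basis element that occurs in `f(x)` can be exchanged for one that does
  not. Comparing the two expressions shows that `f(x) = [b, x]` with `b ∈ lcs N k`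
  (`IsTwist.exists_commutator_eq`). Replacing `x` by `x b`, which is still a basis element, makes
  `f(x) = 1` (`IsTwist.absorb`).
* Then `[a, x] = 1` for every `a` as above, so `a` is central, and `f` commutes with all
  automorphisms that fix `x` (`IsTwist.map_apply_of_map_eq`). Hence, for another basis element `z`,
  the value `f(z)` is a word in `x` and `z` only, and it is linear in `z`, because `f` is
  a homomorphism.
* It is linear in `x` too. Let `β` be the automorphism `x ↦ x t` and `s` the transposition of `x` and
  `t`. The product of `β σ β⁻¹`, the inverse of `s σ s⁻¹` and `σ⁻¹` is trivial modulo
  `lcs N (k + 1)`, so the hypothesis applies to it once more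
  (`IsTwist.map_apply_eq_sq_of_map_apply_eq_sq`).
* Elements of the last term have degree `k + 2 ≥ 3` in the basis, so `x ↦ x²`, `z ↦ z²` raises `f(z)`
  to the power `2 ^ (k + 2)`, whereas bilinearity gives the power `4`. As the last term is torsion
  free, `f(z) = 1`, and `σ` is conjugation by `x` (`IsTwist.eq_one_of_map_eq_one`).

The facts about free nilpotent groups used here (torsion freeness, and the detection of the terms of
the series by commutators with basis elements) come from the theorem of Magnus and Witt
(`Magnus.mem_lcs_succ_of_hasLead_zero`): an element of `lcs F i`, for a free group `F`, lies in
`lcs F (i + 1)` if its Magnus expansion is trivial in degree `i + 1`. It is deduced from the embedding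
of the free Lie ring in the free associative ring (`FreeLieRing.toFree_injective`), which is proved
by Lazard elimination, and questions about commutators become questions about centralizers of
letters in the free associative ring.
-/

/-! ### The free Lie ring embeds in the free associative ring -/

attribute [local instance] LieRing.ofAssociativeRing

namespace FreeLieRing

open FreeLieAlgebra (of)

variable {R : Type*} [CommRing R] {X : Type*}

/-- The Lie homomorphism from the free Lie ring to the free associative ring on the same letters. -/
noncomputable def toFree (R : Type*) [CommRing R] (X : Type*) : FreeLieAlgebra R X →ₗ⁅R⁆ FreeAlgebra R X :=
  FreeLieAlgebra.lift R (FreeAlgebra.ι R)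

@[simp] theorem toFree_of (x : X) : toFree R X (of R x) = FreeAlgebra.ι R x := by
  simp [toFree]

/-- `a` is an iterated Lie bracket, in some arrangement, of exactly `n` letters. -/
inductive IsMonomial : ℕ → FreeLieAlgebra R X → Prop
  | letter (x : X) : IsMonomial 1 (of R x)
  | lie {m n : ℕ} {a b : FreeLieAlgebra R X} :
      IsMonomial m a → IsMonomial n b → IsMonomial (m + n) ⁅a, b⁆

theorem IsMonomial.one_le {n : ℕ} {a : FreeLieAlgebra R X} (h : IsMonomial n a) : 1 ≤ n := by
  induction h with
  | letter => exact le_rfl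
  | lie => omega

/-- The span of the Lie monomials of length at most `n`. -/
noncomputable def degLE (R : Type*) [CommRing R] (X : Type*) (n : ℕ) : Submodule R (FreeLieAlgebra R X) :=
  Submodule.span R {a | ∃ m ≤ n, IsMonomial m a}

theorem IsMonomial.mem_degLE {n : ℕ} {a : FreeLieAlgebra R X} (h : IsMonomial n a) :
    a ∈ degLE R X n :=
  Submodule.subset_span ⟨n, le_rfl, h⟩

theorem degLE_mono : Monotone (degLE R X) := fun _ _ h =>
  Submodule.span_mono fun _ ⟨k, hk, ha⟩ => ⟨k, hk.trans h, ha⟩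

theorem lie_mem_degLE {m n : ℕ} {a b : FreeLieAlgebra R X} (ha : a ∈ degLE R X m)
    (hb : b ∈ degLE R X n) : ⁅a, b⁆ ∈ degLE R X (m + n) := by
  induction ha using Submodule.span_induction with
  | mem a ha =>
    obtain ⟨i, hi, ha⟩ := ha
    induction hb using Submodule.span_induction with
    | mem b hb =>
      obtain ⟨j, hj, hb⟩ := hb
      exact Submodule.subset_span ⟨i + j, by omega, ha.lie hb⟩
    | zero => simp
    | add b c _ _ hb hc => rw [lie_add]; exact add_mem hb hc
    | smul r b _ hb => rw [lie_smul]; exact Submodule.smul_mem _ _ hb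
  | zero => simp
  | add a c _ _ ha hc => rw [add_lie]; exact add_mem ha hc
  | smul r a _ ha => rw [smul_lie]; exact Submodule.smul_mem _ _ ha

theorem induction_of_lie_closed (P : FreeLieAlgebra R X → Prop) (hof : ∀ x, P (of R x))
    (h0 : P 0) (hadd : ∀ a b, P a → P b → P (a + b)) (hsmul : ∀ (r : R) a, P a → P (r • a))
    (hlie : ∀ a b, P a → P b → P ⁅a, b⁆) (a : FreeLieAlgebra R X) : P a := by
  let K : LieSubalgebra R (FreeLieAlgebra R X) :=
    { carrier := {a | P a}
      zero_mem' := h0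
      add_mem' := fun ha hb => hadd _ _ ha hb
      smul_mem' := fun c x hx => hsmul c x hx
      lie_mem' := fun ha hb => hlie _ _ ha hb }
  let f : FreeLieAlgebra R X →ₗ⁅R⁆ K := FreeLieAlgebra.lift R fun x => ⟨of R x, hof x⟩
  have h : K.incl.comp f = LieHom.id := by
    ext x
    simp [f]
  have := LieHom.congr_fun h a
  simp only [LieHom.comp_apply, LieHom.id_apply] at this
  rw [← this]
  exact (f a).2

theorem exists_mem_degLE (a : FreeLieAlgebra R X) : ∃ n, a ∈ degLE R X n := by
  refine induction_of_lie_closed (fun a => ∃ n, a ∈ degLE R X n)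
    (fun x => ⟨1, (IsMonomial.letter x).mem_degLE⟩) ⟨0, zero_mem _⟩ ?_ ?_ ?_ a
  · rintro a b ⟨m, ha⟩ ⟨n, hb⟩
    exact ⟨max m n, add_mem (degLE_mono (le_max_left _ _) ha) (degLE_mono (le_max_right _ _) hb)⟩
  · rintro r a ⟨m, ha⟩
    exact ⟨m, Submodule.smul_mem _ _ ha⟩
  · rintro a b ⟨m, ha⟩ ⟨n, hb⟩
    exact ⟨m + n, lie_mem_degLE ha hb⟩

open Classical in
/-- The endomorphism of the free Lie ring that sends the letters in `S` to zero and fixes the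
others. -/
noncomputable def kill (S : Set X) : FreeLieAlgebra R X →ₗ⁅R⁆ FreeLieAlgebra R X :=
  FreeLieAlgebra.lift R fun x => if x ∈ S then 0 else of R x

open Classical in
@[simp] theorem kill_of (S : Set X) (x : X) :
    kill S (of R x) = if x ∈ S then 0 else of R x := by
  simp [kill]

theorem kill_comp_kill (S T : Set X) (a : FreeLieAlgebra R X) :
    kill S (kill T a) = kill (S ∪ T) a := by
  suffices h : (kill S).comp (kill T) = kill (S ∪ T) from LieHom.congr_fun h a
  ext x
  by_cases h1 : x ∈ T <;> by_cases h2 : x ∈ S <;> simp [h1, h2]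

theorem exists_kill_eq_zero (a : FreeLieAlgebra R X) : ∃ S : Finset X, kill (S : Set X) a = 0 := by
  classical
  refine induction_of_lie_closed (fun a => ∃ S : Finset X, kill (S : Set X) a = 0)
    (fun x => ⟨{x}, by simp⟩) ⟨∅, by simp⟩ ?_ ?_ ?_ a
  · rintro a b ⟨S, ha⟩ ⟨T, hb⟩
    refine ⟨S ∪ T, ?_⟩
    have h1 : kill ((S : Set X) ∪ T) b = 0 := by rw [← kill_comp_kill, hb, map_zero]
    have h2 : kill ((S : Set X) ∪ T) a = 0 := by
      rw [Set.union_comm, ← kill_comp_kill, ha, map_zero]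
    rw [map_add, Finset.coe_union, h1, h2, add_zero]
  · rintro r a ⟨S, ha⟩
    exact ⟨S, by rw [map_smul, ha, smul_zero]⟩
  · rintro a b ⟨S, ha⟩ -
    exact ⟨S, by rw [LieHom.map_lie, ha, zero_lie]⟩

theorem kill_mem_degLE (S : Set X) {n : ℕ} {a : FreeLieAlgebra R X} (ha : a ∈ degLE R X n) :
    kill S a ∈ degLE R X n := by
  have key : ∀ {m a}, IsMonomial m a → kill S a ∈ degLE R X m := by
    intro m a h
    induction h with
    | letter x =>
      rw [kill_of]
      split_ifs
      · exact zero_mem _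
      · exact (IsMonomial.letter x).mem_degLE
    | lie _ _ ha hb => rw [LieHom.map_lie]; exact lie_mem_degLE ha hb
  induction ha using Submodule.span_induction with
  | mem a ha =>
    obtain ⟨i, hi, ha⟩ := ha
    exact degLE_mono hi (key ha)
  | zero => simp
  | add a c _ _ ha hc => rw [map_add]; exact add_mem ha hc
  | smul r a _ ha => rw [map_smul]; exact Submodule.smul_mem _ _ ha

/-- An element killed in the free associative ring stays so after letters are set to zero. -/
theorem toFree_kill_eq_zero (S : Set X) {a : FreeLieAlgebra R X} (ha : toFree R X a = 0) :
    toFree R X (kill S a) = 0 := by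
  classical
  let e : FreeAlgebra R X →ₐ[R] FreeAlgebra R X :=
    FreeAlgebra.lift R fun x => if x ∈ S then 0 else FreeAlgebra.ι R x
  have h : (toFree R X).comp (kill S) = e.toLieHom.comp (toFree R X) := by
    ext x
    by_cases hx : x ∈ S <;> simp [hx, e]
  have := LieHom.congr_fun h a
  simp only [LieHom.comp_apply, ha, map_zero] at this
  exact this

section Elimination

variable (t : X)

/-- The letters produced by eliminating the letter `t`: the letter `(y, i)` stands for the iterated
bracket `[t, [t, …, [t, y]]]` with `i` occurrences of `t`. -/
abbrev ElimLetter (t : X) : Type _ := {y : X // y ≠ t} × ℕ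

/-- The Lie homomorphism that reads the letter `(y, i)` as `(ad t)^i y`. -/
noncomputable def elim : FreeLieAlgebra R (ElimLetter t) →ₗ⁅R⁆ FreeLieAlgebra R X :=
  FreeLieAlgebra.lift R fun p => (fun a => ⁅of R t, a⁆)^[p.2] (of R (p.1 : X))

theorem elim_of (y : {y : X // y ≠ t}) (i : ℕ) :
    elim t (of R (y, i)) = (fun a => ⁅of R t, a⁆)^[i] (of R (y : X)) := by
  simp [elim]

theorem exists_lie_elim {n : ℕ} {a : FreeLieAlgebra R (ElimLetter t)}
    (ha : a ∈ degLE R _ n) : ∃ b ∈ degLE R (ElimLetter t) n, ⁅of R t, elim t a⁆ = elim t b := by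
  have key : ∀ {m a}, IsMonomial m a →
      ∃ b ∈ degLE R (ElimLetter t) m, ⁅of R t, elim t a⁆ = elim t b := by
    intro m a h
    induction h with
    | letter p =>
      obtain ⟨y, i⟩ := p
      refine ⟨of R (y, i + 1), (IsMonomial.letter _).mem_degLE, ?_⟩
      rw [elim_of, elim_of, Function.iterate_succ_apply']
    | @lie m n a b ha hb iha ihb =>
      obtain ⟨a', ha', ea⟩ := iha
      obtain ⟨b', hb', eb⟩ := ihb
      refine ⟨⁅a', b⁆ + ⁅a, b'⁆, add_mem (lie_mem_degLE ha' hb.mem_degLE)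
        (lie_mem_degLE ha.mem_degLE hb'), ?_⟩
      rw [LieHom.map_lie, leibniz_lie, ea, eb, map_add, LieHom.map_lie, LieHom.map_lie]
  induction ha using Submodule.span_induction with
  | mem a ha =>
    obtain ⟨i, hi, ha⟩ := ha
    obtain ⟨b, hb, e⟩ := key ha
    exact ⟨b, degLE_mono hi hb, e⟩
  | zero => exact ⟨0, zero_mem _, by simp⟩
  | add a c _ _ ha hc =>
    obtain ⟨a', ha', ea⟩ := ha
    obtain ⟨c', hc', ec⟩ := hc
    exact ⟨a' + c', add_mem ha' hc', by rw [map_add, lie_add, ea, ec, map_add]⟩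
  | smul r a _ ha =>
    obtain ⟨a', ha', ea⟩ := ha
    exact ⟨r • a', Submodule.smul_mem _ _ ha', by rw [map_smul, lie_smul, ea, map_smul]⟩

/-- The part without `t` of a monomial is a monomial in the letters `(y, 0)`, and the remaining part
is a multiple of `t` plus an element of smaller degree in the letters `(y, i)`. -/
theorem IsMonomial.exists_elim {n : ℕ} {a : FreeLieAlgebra R X} (h : IsMonomial n a) :
    (∃ b ∈ degLE R (ElimLetter t) n, kill {t} a = elim t b) ∧
    ∃ m : R, ∃ c ∈ degLE R (ElimLetter t) (n - 1), a - kill {t} a = m • of R t + elim t c := by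
  induction h with
  | letter x =>
    by_cases hx : x = t
    · subst hx
      exact ⟨⟨0, zero_mem _, by simp⟩, 1, 0, zero_mem _, by simp⟩
    · refine ⟨⟨of R (⟨x, hx⟩, 0), (IsMonomial.letter _).mem_degLE, ?_⟩, 0, 0, zero_mem _, ?_⟩
      · simp [hx, elim_of]
      · simp [hx]
  | @lie p q a b ha hb iha ihb =>
    obtain ⟨⟨a0, ha0, ea0⟩, m, a1, ha1, ea1⟩ := iha
    obtain ⟨⟨b0, hb0, eb0⟩, n, b1, hb1, eb1⟩ := ihb
    have hp := ha.one_le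
    have hq := hb.one_le
    refine ⟨⟨⁅a0, b0⁆, lie_mem_degLE ha0 hb0, by simp [LieHom.map_lie, ea0, eb0]⟩, 0, ?_⟩
    obtain ⟨b0', hb0', eb0'⟩ := exists_lie_elim t hb0
    obtain ⟨b1', hb1', eb1'⟩ := exists_lie_elim t hb1
    obtain ⟨a0', ha0', ea0'⟩ := exists_lie_elim t ha0
    obtain ⟨a1', ha1', ea1'⟩ := exists_lie_elim t ha1
    refine ⟨m • (b0' + b1') - n • a1' + ⁅a1, b0 + b1⁆ - n • a0' + ⁅a0, b1⁆, ?_, ?_⟩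
    · have hb01 : b0 + b1 ∈ degLE R (ElimLetter t) q :=
        add_mem hb0 (degLE_mono (by omega) hb1)
      refine add_mem (sub_mem (add_mem (sub_mem (Submodule.smul_mem _ _ (add_mem ?_ ?_))
        (Submodule.smul_mem _ _ ?_)) ?_) (Submodule.smul_mem _ _ ?_)) ?_
      · exact degLE_mono (by omega) hb0'
      · exact degLE_mono (by omega) hb1'
      · exact degLE_mono (by omega) ha1'
      · exact degLE_mono (by omega) (lie_mem_degLE ha1 hb01)
      · exact degLE_mono (by omega) ha0'
      · exact degLE_mono (by omega) (lie_mem_degLE ha0 hb1)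
    · have ea : a = elim t a0 + (m • of R t + elim t a1) := by rw [← ea0, ← ea1]; abel
      have eb : b = elim t b0 + (n • of R t + elim t b1) := by rw [← eb0, ← eb1]; abel
      have k1 : ⁅elim t a0, of R t⁆ = - elim t a0' := by rw [← ea0', lie_skew]
      have k2 : ⁅elim t a1, of R t⁆ = - elim t a1' := by rw [← ea1', lie_skew]
      rw [LieHom.map_lie, ea0, eb0]
      rw [ea, eb]
      simp only [lie_add, add_lie, map_add, map_sub, map_smul, LieHom.map_lie, smul_lie, lie_smul,
        k1, k2, eb0', eb1', lie_self, zero_smul, smul_neg, smul_add, smul_zero]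
      abel

theorem exists_eq_add_elim {n : ℕ} {a : FreeLieAlgebra R X} (ha : a ∈ degLE R X n)
    (h0 : kill {t} a = 0) :
    ∃ m : R, ∃ c ∈ degLE R (ElimLetter t) (n - 1), a = m • of R t + elim t c := by
  suffices h : ∃ m : R, ∃ c ∈ degLE R (ElimLetter t) (n - 1),
      a - kill {t} a = m • of R t + elim t c by
    rwa [h0, sub_zero] at h
  clear h0
  induction ha using Submodule.span_induction with
  | mem a ha =>
    obtain ⟨i, hi, ha⟩ := ha
    obtain ⟨-, m, c, hc, e⟩ := ha.exists_elim t
    exact ⟨m, c, degLE_mono (by omega) hc, e⟩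
  | zero => exact ⟨0, 0, zero_mem _, by simp⟩
  | add a b _ _ ha hb =>
    obtain ⟨m, c, hc, e⟩ := ha
    obtain ⟨n, d, hd, e'⟩ := hb
    refine ⟨m + n, c + d, add_mem hc hd, ?_⟩
    rw [map_add, map_add, add_smul, add_sub_add_comm, e, e']
    abel
  | smul r a _ ha =>
    obtain ⟨m, c, hc, e⟩ := ha
    refine ⟨r * m, r • c, Submodule.smul_mem _ _ hc, ?_⟩
    rw [map_smul, map_smul, ← smul_sub, e, smul_add, mul_smul]

/-- The derivation of the free associative ring with `(y, i) ↦ (y, i + 1)`, encoded as a ring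
homomorphism to the dual numbers. -/
noncomputable def shiftDual :
    FreeAlgebra R (ElimLetter t) →ₐ[R]
      TrivSqZeroExt (FreeAlgebra R (ElimLetter t)) (FreeAlgebra R (ElimLetter t)) :=
  FreeAlgebra.lift R fun p =>
    TrivSqZeroExt.inl (FreeAlgebra.ι R p) + TrivSqZeroExt.inr (FreeAlgebra.ι R (p.1, p.2 + 1))

theorem fst_shiftDual (a : FreeAlgebra R (ElimLetter t)) : (shiftDual t a).fst = a := by
  suffices h : (TrivSqZeroExt.fstHom R _ _).comp (shiftDual t) = AlgHom.id R _ from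
    DFunLike.congr_fun h a
  ext p
  simp [shiftDual]

/-- The derivation of the free associative ring with `(y, i) ↦ (y, i + 1)`, as an additive
endomorphism. -/
noncomputable def shift : Module.End R (FreeAlgebra R (ElimLetter t)) :=
  (TrivSqZeroExt.sndHom (FreeAlgebra R (ElimLetter t)) (FreeAlgebra R (ElimLetter t))).restrictScalars R
    ∘ₗ (shiftDual t).toLinearMap

theorem shift_ι (y : {y : X // y ≠ t}) (i : ℕ) :
    shift t (FreeAlgebra.ι R (y, i)) = FreeAlgebra.ι R (y, i + 1) := by
  simp [shift, shiftDual]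

theorem shift_mul (a b : FreeAlgebra R (ElimLetter t)) :
    shift t (a * b) = a * shift t b + shift t a * b := by
  simp [shift, fst_shiftDual]

theorem shift_one : shift (R := R) t 1 = 0 := by
  simp [shift]

open Classical in
/-- The free associative ring on `X` acts on the free associative ring on the letters `(y, i)`: the
letter `t` by the derivation `shift t`, and a letter `y ≠ t` by left multiplication by `(y, 0)`. -/
noncomputable def elimAction :
    FreeAlgebra R X →ₐ[R] Module.End R (FreeAlgebra R (ElimLetter t)) :=
  FreeAlgebra.lift R fun x =>
    if h : x = t then shift t else LinearMap.mulLeft R (FreeAlgebra.ι R (⟨x, h⟩, 0))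

theorem elimAction_t : elimAction t (FreeAlgebra.ι R t) = shift t := by
  simp [elimAction]

/-- An element of the free Lie ring on the letters `(y, i)` acts by left multiplication. -/
theorem elimAction_toFree_elim (a : FreeLieAlgebra R (ElimLetter t)) :
    elimAction t (toFree R X (elim t a)) = LinearMap.mulLeft R (toFree R _ a) := by
  have h : ((elimAction t).toLieHom.comp (toFree R X)).comp (elim t) =
      (Algebra.lmul R (FreeAlgebra R (ElimLetter t))).toLieHom.comp (toFree R _) := by
    ext ⟨y, i⟩ : 1
    simp only [LieHom.comp_apply, elim_of, toFree_of, AlgHom.coe_toLieHom]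
    induction i with
    | zero =>
      ext1 b
      simp [elimAction, y.2]
    | succ i ih =>
      rw [Function.iterate_succ_apply', LieHom.map_lie, toFree_of, LieRing.of_associative_ring_bracket,
        map_sub, map_mul, map_mul, ih, elimAction_t]
      ext1 b
      simp [shift_mul, shift_ι]
  have := LieHom.congr_fun h a
  ext1 b
  simpa using DFunLike.congr_fun this b

end Elimination

universe u

/-- Lazard elimination: an element of the kernel may be assumed to vanish when the letter `t` is set
to zero, and is then a multiple of `t` plus an element of smaller degree in the letters `(y, i)`. -/
theorem eq_zero_of_toFree_eq_zero (n : ℕ) : ∀ {X : Type u} {a : FreeLieAlgebra R X},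
    a ∈ degLE R X n → toFree R X a = 0 → a = 0 := by
  induction n with
  | zero =>
    intro X a ha _
    have : {a : FreeLieAlgebra R X | ∃ m ≤ 0, IsMonomial m a} = ∅ := by
      ext b
      simp only [Set.mem_ofPred_eq, Set.mem_empty_iff_false, iff_false]
      rintro ⟨m, hm, hb⟩
      have := hb.one_le
      omega
    rw [degLE, this, Submodule.span_empty] at ha
    exact ha
  | succ n ih =>
    intro X a ha h0
    obtain ⟨S, hS⟩ := exists_kill_eq_zero a
    classical
    induction S using Finset.induction_on generalizing a with
    | empty =>
      have h : kill (R := R) (∅ : Set X) = LieHom.id := by ext x; simp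
      rw [Finset.coe_empty, h] at hS
      exact hS
    | insert t S _ ihS =>
      have hk : kill {t} a = 0 := by
        refine ihS (kill_mem_degLE _ ha) (toFree_kill_eq_zero _ h0) ?_
        rw [kill_comp_kill, ← hS, Finset.coe_insert, Set.union_singleton]
      obtain ⟨m, c, hc, rfl⟩ := exists_eq_add_elim t ha hk
      -- Acting on the unit, `t` gives zero and `elim t c` gives the image of `c`.
      have h1 : toFree R _ c = 0 := by
        have := congrArg (fun p => elimAction t p 1) h0
        simpa [elimAction_toFree_elim, elimAction_t, shift_one] using this
      have hc0 : c = 0 := ih hc h1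
      subst hc0
      have h2 : m = 0 := by
        have := congrArg (FreeAlgebra.lift R fun _ : X => (1 : R)) h0
        simpa using this
      simp [h2]

/-- **Witt's theorem** over any commutative ring: the free Lie algebra embeds in the free
associative algebra. -/
theorem toFree_injective (R : Type*) [CommRing R] (X : Type u) :
    Function.Injective (toFree R X) := by
  refine (injective_iff_map_eq_zero _).2 fun a ha => ?_
  obtain ⟨n, hn⟩ := exists_mem_degLE a
  exact eq_zero_of_toFree_eq_zero n hn ha

end FreeLieRing

/-! ### The Lie ring of the lower central series -/

open scoped commutatorElement

section LowerCentral

variable {G : Type*} [Group G]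

variable (G) in
/-- The lower central series of the whole group, with Mathlib's indexing `lcs G 0 = G`. -/
abbrev lcs (i : ℕ) : Subgroup G := (⊤ : Subgroup G).lowerCentralSeries i

theorem lcs_antitone : Antitone (lcs G) := Subgroup.lowerCentralSeries_antitone _

theorem Subgroup.commutator_commutator_le_of_rotate {H₁ H₂ H₃ K : Subgroup G} [K.Normal]
    (h1 : ⁅⁅H₂, H₃⁆, H₁⁆ ≤ K) (h2 : ⁅⁅H₃, H₁⁆, H₂⁆ ≤ K) : ⁅⁅H₁, H₂⁆, H₃⁆ ≤ K := by
  have key : ∀ L : Subgroup G, L ≤ K ↔ L.map (QuotientGroup.mk' K) = ⊥ := fun L => by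
    rw [Subgroup.map_eq_bot_iff, QuotientGroup.ker_mk']
  rw [key] at h1 h2 ⊢
  simp only [Subgroup.map_commutator] at h1 h2 ⊢
  exact Subgroup.commutator_commutator_eq_bot_of_rotate h1 h2

theorem commutator_lcs_le (i j : ℕ) : ⁅lcs G i, lcs G j⁆ ≤ lcs G (i + j + 1) := by
  induction j generalizing i with
  | zero => exact le_rfl
  | succ j ih =>
    rw [Subgroup.commutator_comm]
    refine Subgroup.commutator_commutator_le_of_rotate ?_ ?_
    · rw [Subgroup.commutator_comm ⊤]
      exact (ih (i + 1)).trans (lcs_antitone (by omega))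
    · exact Subgroup.commutator_mono (ih i) le_rfl

theorem commutator_mem_lcs {i j k : ℕ} (hk : k ≤ i + j + 1) {g h : G} (hg : g ∈ lcs G i)
    (hh : h ∈ lcs G j) : ⁅g, h⁆ ∈ lcs G k :=
  lcs_antitone hk (commutator_lcs_le i j (Subgroup.commutator_mem_commutator hg hh))

/-- The Leibniz form of the Hall–Witt identity, for elements whose deeper commutators vanish. -/
theorem commutator_commutator_eq_mul {a b c : G} (h1 : Commute ⁅a, b⁆ ⁅b, ⁅a, c⁆ * c⁆)
    (h2 : Commute ⁅a, c⁆ ⁅b, c⁆) (h3 : Commute ⁅a, b⁆ ⁅a, c⁆) (h4 : Commute ⁅a, c⁆ ⁅⁅a, b⁆, c⁆)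
    (h5 : Commute ⁅⁅a, b⁆, c⁆ ⁅b, c⁆) : ⁅a, ⁅b, c⁆⁆ = ⁅b, ⁅a, c⁆⁆ * ⁅⁅a, b⁆, c⁆ := by
  have e : ⁅a, ⁅b, c⁆⁆ * ⁅b, c⁆ = ⁅⁅a, b⁆ * b, ⁅a, c⁆ * c⁆ := by
    simp only [commutatorElement_def]; group
  set u := ⁅a, b⁆
  set v := ⁅a, c⁆
  rw [commutatorElement_mul_left_eq_conj_mul, h1.eq, mul_inv_cancel_right,
    commutatorElement_mul_right_eq_mul_conj b, commutatorElement_mul_right_eq_mul_conj u,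
    h3.commutator_eq, one_mul, mul_assoc ⁅b, v⁆, h2.eq, ← mul_assoc ⁅b, v⁆, mul_inv_cancel_right,
    h4.eq, mul_inv_cancel_right, mul_assoc, ← h5.eq, ← mul_assoc] at e
  exact mul_right_cancel e

theorem commute_mk {i j k : ℕ} (hk : k ≤ i + j + 1) {g h : G} (hg : g ∈ lcs G i)
    (hh : h ∈ lcs G j) : Commute (g : G ⧸ lcs G k) (h : G ⧸ lcs G k) := by
  rw [← commutatorElement_eq_one_iff_commute]
  exact (QuotientGroup.eq_one_iff _).2 (commutator_mem_lcs hk hg hh)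

theorem leibniz_mem_lcs {i j l n : ℕ} (hn : n ≤ i + j + l + 3) {a b c : G} (ha : a ∈ lcs G i)
    (hb : b ∈ lcs G j) (hc : c ∈ lcs G l) :
    ⁅a, ⁅b, c⁆⁆⁻¹ * (⁅b, ⁅a, c⁆⁆ * ⁅⁅a, b⁆, c⁆) ∈ lcs G n := by
  rw [← QuotientGroup.eq]
  have hab : ⁅a, b⁆ ∈ lcs G (i + j + 1) := commutator_mem_lcs le_rfl ha hb
  have hac : ⁅a, c⁆ ∈ lcs G (i + l + 1) := commutator_mem_lcs le_rfl ha hc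
  have hbc : ⁅b, c⁆ ∈ lcs G (j + l + 1) := commutator_mem_lcs le_rfl hb hc
  have hw : ⁅a, c⁆ * c ∈ lcs G l := mul_mem (lcs_antitone (by omega) hac) hc
  have hbw : ⁅b, ⁅a, c⁆ * c⁆ ∈ lcs G (j + l + 1) := commutator_mem_lcs le_rfl hb hw
  have habc : ⁅⁅a, b⁆, c⁆ ∈ lcs G (i + j + l + 2) := commutator_mem_lcs (by omega) hab hc
  exact commutator_commutator_eq_mul (G := G ⧸ lcs G n) (a := a) (b := b) (c := c)
    (commute_mk (by omega) hab hbw) (commute_mk (by omega) hac hbc)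
    (commute_mk (by omega) hab hac) (commute_mk (by omega) hac habc)
    (commute_mk (by omega) habc hbc)

variable (G) in
/-- A factor of the lower central series, written multiplicatively. -/
abbrev LCSFactor (i : ℕ) : Type _ := lcs G i ⧸ (lcs G (i + 1)).subgroupOf (lcs G i)

namespace LCSFactor

/-- The class of an element of the lower central series in the corresponding factor. -/
def cls (i : ℕ) : lcs G i →* LCSFactor G i := QuotientGroup.mk' _

theorem cls_eq_one_iff {i : ℕ} (g : lcs G i) : cls i g = 1 ↔ (g : G) ∈ lcs G (i + 1) := by
  rw [cls, QuotientGroup.mk'_apply, QuotientGroup.eq_one_iff, Subgroup.mem_subgroupOf]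

theorem cls_eq_cls_iff {i : ℕ} (g h : lcs G i) :
    cls i g = cls i h ↔ (g : G)⁻¹ * h ∈ lcs G (i + 1) := by
  rw [cls, QuotientGroup.mk'_apply, QuotientGroup.mk'_apply, QuotientGroup.eq,
    Subgroup.mem_subgroupOf]
  rfl

theorem cls_surjective (i : ℕ) : Function.Surjective (cls (G := G) i) :=
  QuotientGroup.mk'_surjective _

instance (i : ℕ) : CommGroup (LCSFactor G i) :=
  { (inferInstance : Group (LCSFactor G i)) with
    mul_comm := by
      intro a b
      obtain ⟨g, rfl⟩ := cls_surjective i a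
      obtain ⟨h, rfl⟩ := cls_surjective i b
      rw [← map_mul, ← map_mul, cls_eq_cls_iff]
      have : ((g * h : lcs G i) : G)⁻¹ * ((h * g : lcs G i) : G) = ⁅(h : G)⁻¹, (g : G)⁻¹⁆ := by
        simp only [commutatorElement_def, Subgroup.coe_mul]; group
      rw [this]
      exact commutator_mem_lcs (by omega) (inv_mem h.2) (inv_mem g.2) }

/-- The commutator of elements of two terms of the lower central series. -/
def comm {i j : ℕ} (g : lcs G i) (h : lcs G j) : lcs G (i + j + 1) :=
  ⟨⁅(g : G), (h : G)⁆, commutator_mem_lcs le_rfl g.2 h.2⟩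

theorem cls_comm_mul_right {i j : ℕ} (g : lcs G i) (h k : lcs G j) :
    cls _ (comm g (h * k)) = cls _ (comm g h) * cls _ (comm g k) := by
  let d : lcs G (i + j + 1) :=
    ⟨⁅(h : G), ⁅(g : G), (k : G)⁆⁆, commutator_mem_lcs (by omega) h.2 (comm g k).2⟩
  have e : comm g (h * k) = comm g h * (d * comm g k) := by
    ext
    simp only [d, comm, Subgroup.coe_mul, commutatorElement_def]; group
  have hd : cls _ d = 1 :=
    (cls_eq_one_iff _).2 (commutator_mem_lcs (by omega) h.2 (comm g k).2)
  rw [e, map_mul, map_mul, hd, one_mul]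

theorem cls_comm_mul_left {i j : ℕ} (g h : lcs G i) (k : lcs G j) :
    cls _ (comm (g * h) k) = cls _ (comm g k) * cls _ (comm h k) := by
  let d : lcs G (i + j + 1) :=
    ⟨⁅(g : G), ⁅(h : G), (k : G)⁆⁆, commutator_mem_lcs (by omega) g.2 (comm h k).2⟩
  have e : comm (g * h) k = d * comm h k * comm g k := by
    ext
    simp only [d, comm, Subgroup.coe_mul, commutatorElement_def]; group
  have hd : cls _ d = 1 :=
    (cls_eq_one_iff _).2 (commutator_mem_lcs (by omega) g.2 (comm h k).2)
  rw [e, map_mul, map_mul, hd, one_mul, mul_comm]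

/-- The commutator with a fixed element, as a homomorphism between factors. -/
def brRight {i : ℕ} (j : ℕ) (g : lcs G i) : LCSFactor G j →* LCSFactor G (i + j + 1) :=
  QuotientGroup.lift _ (MonoidHom.mk' (fun h => cls _ (comm g h)) (cls_comm_mul_right g))
    fun h hh => (cls_eq_one_iff _).2 <|
      commutator_mem_lcs (j := j + 1) (by omega) g.2 (Subgroup.mem_subgroupOf.1 hh)

/-- The commutator as a bilinear map on the factors of the lower central series. -/
def br (i j : ℕ) : LCSFactor G i →* LCSFactor G j →* LCSFactor G (i + j + 1) :=
  QuotientGroup.lift _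
    (MonoidHom.mk' (fun g => brRight j g) fun g h => by
      ext k
      exact cls_comm_mul_left g h k)
    fun g hg => by
      ext k
      exact (cls_eq_one_iff _).2
        (commutator_mem_lcs (i := i + 1) (by omega) (Subgroup.mem_subgroupOf.1 hg) k.2)

@[simp] theorem br_cls {i j : ℕ} (g : lcs G i) (h : lcs G j) :
    br i j (cls i g) (cls j h) = cls _ (comm g h) := rfl

end LCSFactor

variable (G) in
/-- The graded abelian group of the lower central series; the factor of `lcs G i` sits in
index `i`, which is degree `i + 1`. -/
def LCSRing : Type _ := DirectSum ℕ fun i => Additive (LCSFactor G i)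

namespace LCSRing

open LCSFactor

instance : AddCommGroup (LCSRing G) :=
  inferInstanceAs (AddCommGroup (DirectSum ℕ fun i => Additive (LCSFactor G i)))

/-- The inclusion of a homogeneous component. -/
def ofFactor (i : ℕ) : Additive (LCSFactor G i) →+ LCSRing G :=
  DirectSum.of (fun i => Additive (LCSFactor G i)) i

theorem ofFactor_injective (i : ℕ) : Function.Injective (ofFactor (G := G) i) :=
  DirectSum.of_injective i

/-- The additive map out of the graded group given by its values on homogeneous components. -/
def lift {A : Type*} [AddCommGroup A] (f : ∀ i, Additive (LCSFactor G i) →+ A) : LCSRing G →+ A :=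
  DirectSum.toAddMonoid f

theorem lift_ofFactor {A : Type*} [AddCommGroup A] (f : ∀ i, Additive (LCSFactor G i) →+ A) (i : ℕ)
    (a : Additive (LCSFactor G i)) : lift f (ofFactor i a) = f i a :=
  DirectSum.toAddMonoid_of f i a

/-- The homogeneous element given by an element of the lower central series. -/
def single (i : ℕ) (g : lcs G i) : LCSRing G :=
  ofFactor i (Additive.ofMul (cls i g))

theorem single_mul (i : ℕ) (g h : lcs G i) : single i (g * h) = single i g + single i h := by
  simp only [single, map_mul, ofMul_mul, map_add]

theorem single_one (i : ℕ) : single i (1 : lcs G i) = 0 := by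
  simp only [single, map_one, ofMul_one, map_zero]

theorem single_inv (i : ℕ) (g : lcs G i) : single i g⁻¹ = - single i g := by
  simp only [single, map_inv, ofMul_inv, map_neg]

theorem single_eq_zero_iff {i : ℕ} (g : lcs G i) : single i g = 0 ↔ (g : G) ∈ lcs G (i + 1) := by
  rw [← cls_eq_one_iff, single, ← map_zero (ofFactor i),
    (ofFactor_injective i).eq_iff, ofMul_eq_zero]

theorem single_eq_of_mem {i : ℕ} {g h : lcs G i} (e : (g : G)⁻¹ * h ∈ lcs G (i + 1)) :
    single i g = single i h := by
  rw [single, single, (cls_eq_cls_iff g h).2 e]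

theorem single_congr {i j : ℕ} (hij : i = j) {g : lcs G i} {h : lcs G j} (e : (g : G) = h) :
    single i g = single j h := by
  subst hij
  rw [Subtype.ext e]

protected theorem induction_on {P : LCSRing G → Prop} (a : LCSRing G) (h0 : P 0)
    (hs : ∀ i g, P (single i g)) (hadd : ∀ a b, P a → P b → P (a + b)) : P a := by
  refine DirectSum.induction_on (motive := P) a h0 (fun i x => ?_) hadd
  obtain ⟨g, hg⟩ := cls_surjective i x.toMul
  have := hs i g
  rwa [single, hg] at this

/-- The bracket of two homogeneous components. -/
def brFactor (i j : ℕ) : Additive (LCSFactor G i) →+ Additive (LCSFactor G j) →+ LCSRing G :=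
  AddMonoidHom.mk' (fun a => (ofFactor (i + j + 1)).comp (MonoidHom.toAdditive (br i j a.toMul)))
    fun a b => by
      rw [toMul_add, map_mul, ← AddMonoidHom.comp_add]
      rfl

/-- The bracket of the Lie ring, as a biadditive map. -/
def brHom : LCSRing G →+ LCSRing G →+ LCSRing G :=
  lift fun i => AddMonoidHom.flip <| lift fun j => AddMonoidHom.flip <| brFactor i j

instance : Bracket (LCSRing G) (LCSRing G) := ⟨fun a b => brHom a b⟩

theorem lie_single {i j : ℕ} (g : lcs G i) (h : lcs G j) :
    ⁅single i g, single j h⁆ = single (i + j + 1) (LCSFactor.comm g h) := by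
  change brHom (single i g) (single j h) = _
  rw [single, single, brHom, lift_ofFactor, AddMonoidHom.flip_apply, lift_ofFactor]
  rfl

protected theorem add_lie (a b c : LCSRing G) : ⁅a + b, c⁆ = ⁅a, c⁆ + ⁅b, c⁆ := by
  change brHom _ _ = brHom _ _ + brHom _ _
  rw [map_add, AddMonoidHom.add_apply]

protected theorem lie_add (a b c : LCSRing G) : ⁅a, b + c⁆ = ⁅a, b⁆ + ⁅a, c⁆ :=
  map_add (brHom a) b c

protected theorem zero_lie (a : LCSRing G) : ⁅(0 : LCSRing G), a⁆ = 0 := by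
  change brHom _ _ = _
  rw [map_zero, AddMonoidHom.zero_apply]

protected theorem lie_zero (a : LCSRing G) : ⁅a, (0 : LCSRing G)⁆ = 0 := map_zero (brHom a)

theorem lie_add_lie_swap (a b : LCSRing G) : ⁅a, b⁆ + ⁅b, a⁆ = 0 := by
  induction a using LCSRing.induction_on with
  | h0 => rw [LCSRing.zero_lie, LCSRing.lie_zero, add_zero]
  | hadd a a' ha ha' =>
    rw [LCSRing.add_lie, LCSRing.lie_add, add_add_add_comm, ha, ha', add_zero]
  | hs i g =>
    induction b using LCSRing.induction_on with
    | h0 => rw [LCSRing.zero_lie, LCSRing.lie_zero, add_zero]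
    | hadd a a' ha ha' =>
      rw [LCSRing.add_lie, LCSRing.lie_add, add_add_add_comm, ha, ha', add_zero]
    | hs j h =>
      rw [lie_single, lie_single, add_eq_zero_iff_eq_neg, ← single_inv]
      exact single_congr (by omega) (commutatorElement_inv (h : G) (g : G)).symm

instance : LieRing (LCSRing G) where
  add_lie := LCSRing.add_lie
  lie_add := LCSRing.lie_add
  lie_self a := by
    induction a using LCSRing.induction_on with
    | h0 => exact LCSRing.lie_zero 0
    | hadd a b ha hb =>
      rw [LCSRing.add_lie, LCSRing.lie_add, LCSRing.lie_add, ha, hb, zero_add, add_zero,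
        lie_add_lie_swap]
    | hs i g =>
      rw [lie_single, single_eq_zero_iff]
      simp [LCSFactor.comm]
  leibniz_lie a b c := by
    induction a using LCSRing.induction_on with
    | h0 => simp only [LCSRing.zero_lie, LCSRing.lie_zero, add_zero]
    | hadd a a' ha ha' =>
      simp only [LCSRing.add_lie, LCSRing.lie_add, ha, ha']
      abel
    | hs i x =>
    induction b using LCSRing.induction_on with
    | h0 => simp only [LCSRing.zero_lie, LCSRing.lie_zero, add_zero]
    | hadd a a' ha ha' =>
      simp only [LCSRing.add_lie, LCSRing.lie_add, ha, ha']
      abel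
    | hs j y =>
    induction c using LCSRing.induction_on with
    | h0 => simp only [LCSRing.lie_zero, add_zero]
    | hadd a a' ha ha' =>
      simp only [LCSRing.lie_add, ha, ha']
      abel
    | hs k z =>
      simp only [lie_single]
      let p : lcs G (i + (j + k + 1) + 1) :=
        ⟨⁅⁅(x : G), (y : G)⁆, (z : G)⁆, commutator_mem_lcs (by omega) (LCSFactor.comm x y).2 z.2⟩
      let q : lcs G (i + (j + k + 1) + 1) :=
        ⟨⁅(y : G), ⁅(x : G), (z : G)⁆⁆, commutator_mem_lcs (by omega) y.2 (LCSFactor.comm x z).2⟩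
      have e : single _ (LCSFactor.comm x (LCSFactor.comm y z)) = single _ (q * p) :=
        single_eq_of_mem (leibniz_mem_lcs (by omega) x.2 y.2 z.2)
      rw [e, single_mul, add_comm]
      exact congrArg₂ (· + ·) (single_congr (by omega) rfl) (single_congr (by omega) rfl)

end LCSRing

end LowerCentral

/-! ### Centralizers of letters in the free associative ring -/

namespace FreeAlgebra

variable {X : Type*}

open MonoidAlgebra in
theorem monoidAlgebra_mem_adjoin_of_commute {x : X} {a : MonoidAlgebra ℤ (FreeMonoid X)}
    (h : a * single (FreeMonoid.of x) 1 = single (FreeMonoid.of x) 1 * a) :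
    a ∈ Algebra.adjoin ℤ {(single (FreeMonoid.of x) 1 : MonoidAlgebra ℤ (FreeMonoid X))} := by
  have hr : ∀ w, (a * single (FreeMonoid.of x) 1).coeff (w * FreeMonoid.of x) = a.coeff w :=
    fun w => by rw [coeff_mul_single_eq_coeff_mul w fun _ _ => mul_left_inj _, mul_one]
  have hl : ∀ w, (single (FreeMonoid.of x) 1 * a).coeff (FreeMonoid.of x * w) = a.coeff w :=
    fun w => by rw [coeff_single_mul_eq_mul_coeff w fun _ _ => mul_right_inj _, one_mul]
  have h0 : ∀ y w, y ≠ x → a.coeff (FreeMonoid.of y * w) = 0 := fun y w hy => by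
    rw [← hr, h, mul_assoc, coeff_single_mul_of_forall_mul_ne]
    intro d hd
    have := congrArg FreeMonoid.toList hd
    simp only [FreeMonoid.toList_mul, FreeMonoid.toList_of, List.singleton_append,
      List.cons.injEq] at this
    exact hy this.1.symm
  have hx : ∀ w, a.coeff (FreeMonoid.of x * w) = a.coeff (w * FreeMonoid.of x) := fun w => by
    rw [← hr, h, mul_assoc, hl]
  have hk : ∀ (k : ℕ) (y : X) (w), y ≠ x →
      a.coeff (FreeMonoid.of x ^ k * (FreeMonoid.of y * w)) = 0 := fun k => by
    induction k with
    | zero => intro y w hy; rw [pow_zero, one_mul, h0 y w hy]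
    | succ k ih => intro y w hy; rw [pow_succ', mul_assoc, hx, mul_assoc, mul_assoc, ih y _ hy]
  have hw : ∀ w : FreeMonoid X, (∃ n, w = FreeMonoid.of x ^ n) ∨
      ∃ k y u, y ≠ x ∧ w = FreeMonoid.of x ^ k * (FreeMonoid.of y * u) := fun w => by
    induction w using FreeMonoid.recOn with
    | one => exact Or.inl ⟨0, (pow_zero _).symm⟩
    | of_mul y w ih =>
      by_cases hy : y = x
      · subst hy
        rcases ih with ⟨n, rfl⟩ | ⟨k, z, u, hz, rfl⟩
        · exact Or.inl ⟨n + 1, (pow_succ' _ _).symm⟩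
        · exact Or.inr ⟨k + 1, z, u, hz, by rw [pow_succ', mul_assoc]⟩
      · exact Or.inr ⟨0, y, w, hy, by rw [pow_zero, one_mul]⟩
  rw [← a.sum_coeff_single]
  refine sum_mem fun w _ => ?_
  rcases hw w with ⟨n, rfl⟩ | ⟨k, y, u, hy, rfl⟩
  · have e : (single (FreeMonoid.of x ^ n) (a.coeff (FreeMonoid.of x ^ n)) :
        MonoidAlgebra ℤ (FreeMonoid X)) =
        a.coeff (FreeMonoid.of x ^ n) • (single (FreeMonoid.of x) 1) ^ n := by
      rw [single_pow, one_pow, smul_single, smul_eq_mul, mul_one]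
    rw [e]
    exact Subalgebra.smul_mem _ (pow_mem (Algebra.subset_adjoin (Set.mem_singleton _)) n) _
  · rw [hk k y u hy, single_zero]
    exact zero_mem _

/-- The centralizer of a letter consists of the polynomials in that letter. -/
theorem exists_aeval_eq_of_commute {x : X} {a : FreeAlgebra ℤ X} (h : a * ι ℤ x = ι ℤ x * a) :
    ∃ q : Polynomial ℤ, Polynomial.aeval (ι ℤ x) q = a := by
  let e := equivMonoidAlgebraFreeMonoid (R := ℤ) (X := X)
  have hx : e (ι ℤ x) = MonoidAlgebra.single (FreeMonoid.of x) 1 := by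
    simp [e, equivMonoidAlgebraFreeMonoid]
  have h1 := congrArg e h
  rw [map_mul, map_mul, hx] at h1
  have h2 := monoidAlgebra_mem_adjoin_of_commute h1
  rw [Algebra.adjoin_singleton_eq_range_aeval] at h2
  obtain ⟨q, hq⟩ := h2
  refine ⟨q, e.injective ?_⟩
  rw [← hq, ← hx]
  exact (Polynomial.aeval_algHom_apply e.toAlgHom (ι ℤ x) q).symm

theorem eq_zero_of_commute_of_lift_X_eq_zero {x : X} {a : FreeAlgebra ℤ X}
    (h : a * ι ℤ x = ι ℤ x * a) (h0 : lift ℤ (fun _ => (Polynomial.X : Polynomial ℤ)) a = 0) :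
    a = 0 := by
  obtain ⟨q, rfl⟩ := exists_aeval_eq_of_commute h
  rw [← Polynomial.aeval_algHom_apply, lift_ι_apply, Polynomial.aeval_X_left_apply] at h0
  rw [h0, map_zero]

theorem eq_zero_of_commute_of_commute {x z : X} (hxz : x ≠ z) {a : FreeAlgebra ℤ X}
    (hx : a * ι ℤ x = ι ℤ x * a) (hz : a * ι ℤ z = ι ℤ z * a)
    (h0 : lift ℤ (fun _ => (0 : ℤ)) a = 0) : a = 0 := by
  classical
  obtain ⟨q, rfl⟩ := exists_aeval_eq_of_commute hx
  obtain ⟨r, hr⟩ := exists_aeval_eq_of_commute hz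
  let f : FreeAlgebra ℤ X →ₐ[ℤ] Polynomial ℤ :=
    lift ℤ fun y => if y = x then Polynomial.X else 0
  have h1 := congrArg f hr
  rw [← Polynomial.aeval_algHom_apply, ← Polynomial.aeval_algHom_apply] at h1
  simp only [f, lift_ι_apply, if_neg hxz.symm, if_true, Polynomial.aeval_X_left_apply] at h1
  rw [← Polynomial.aeval_algHom_apply, lift_ι_apply] at h0
  rw [← Polynomial.coeff_zero_eq_aeval_zero'] at h1
  rw [← h1, ← Polynomial.C_eq_algebraMap, Polynomial.aeval_C] at h0
  rw [← h1, ← Polynomial.C_eq_algebraMap, Polynomial.aeval_C, show r.coeff 0 = 0 from h0, map_zero]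

end FreeAlgebra

/-! ### The Magnus expansion -/

namespace Magnus

open PowerSeries FreeLieRing

universe u

variable {X : Type u}

/-- The power series `1 + a T`, as a unit. -/
noncomputable def unitOneAdd {A : Type*} [Ring A] (a : A) : (PowerSeries A)ˣ where
  val := 1 + PowerSeries.X * C a
  inv := mk fun n => (-a) ^ n
  val_inv := by
    ext n
    rw [add_mul, one_mul, map_add, mul_assoc]
    cases n with
    | zero => simp
    | succ n => simp [coeff_succ_X_mul, pow_succ', coeff_one]
  inv_val := by
    ext n
    rw [mul_add, mul_one, map_add, ← mul_assoc, (commute_X _).eq, mul_assoc]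
    cases n with
    | zero => simp
    | succ n => simp [coeff_succ_X_mul, pow_succ, coeff_one]

/-- The Magnus expansion of a free group, with values in power series in a central variable `T` over
the free associative ring: a letter `x` goes to `1 + x T`. -/
noncomputable def expansion (X : Type u) : FreeGroup X →* (PowerSeries (FreeAlgebra ℤ X))ˣ :=
  FreeGroup.lift fun x => unitOneAdd (FreeAlgebra.ι ℤ x)

theorem constantCoeff_expansion (g : FreeGroup X) :
    constantCoeff (expansion X g : PowerSeries (FreeAlgebra ℤ X)) = 1 := by
  suffices h : (Units.map (constantCoeff (R := FreeAlgebra ℤ X)).toMonoidHom).comp (expansion X) = 1 by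
    have := congrArg Units.val (DFunLike.congr_fun h g)
    simpa using this
  ext x
  simp [expansion, unitOneAdd]

/-- The Magnus expansion of `g` is `1 + a T ^ (i + 1)` modulo higher powers of `T`. -/
def HasLead (i : ℕ) (g : FreeGroup X) (a : FreeAlgebra ℤ X) : Prop :=
  ∃ v : PowerSeries (FreeAlgebra ℤ X),
    (expansion X g : PowerSeries (FreeAlgebra ℤ X)) = 1 + PowerSeries.X ^ (i + 1) * v ∧
      constantCoeff v = a

theorem HasLead.of (x : X) : HasLead 0 (FreeGroup.of x) (FreeAlgebra.ι ℤ x) :=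
  ⟨C (FreeAlgebra.ι ℤ x), by simp [expansion, unitOneAdd], by simp⟩

theorem HasLead.one (i : ℕ) : HasLead i (1 : FreeGroup X) 0 := ⟨0, by simp, by simp⟩

theorem HasLead.unique {i : ℕ} {g : FreeGroup X} {a b : FreeAlgebra ℤ X} (ha : HasLead i g a)
    (hb : HasLead i g b) : a = b := by
  obtain ⟨v, hv, rfl⟩ := ha
  obtain ⟨w, hw, rfl⟩ := hb
  have h := congrArg (coeff (i + 1)) (hv.symm.trans hw)
  simpa [coeff_X_pow_mul'] using h

theorem HasLead.mul {i : ℕ} {g h : FreeGroup X} {a b : FreeAlgebra ℤ X} (ha : HasLead i g a)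
    (hb : HasLead i h b) : HasLead i (g * h) (a + b) := by
  obtain ⟨v, hv, rfl⟩ := ha
  obtain ⟨w, hw, rfl⟩ := hb
  refine ⟨v + w + v * (PowerSeries.X ^ (i + 1) * w), ?_, by simp⟩
  rw [map_mul, Units.val_mul, hv, hw]
  noncomm_ring

theorem HasLead.inv {i : ℕ} {g : FreeGroup X} {a : FreeAlgebra ℤ X} (ha : HasLead i g a) :
    HasLead i g⁻¹ (-a) := by
  obtain ⟨v, hv, rfl⟩ := ha
  refine ⟨-(v * (expansion X g⁻¹ : PowerSeries (FreeAlgebra ℤ X))), ?_, ?_⟩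
  · have h : (expansion X g : PowerSeries (FreeAlgebra ℤ X)) * (expansion X g⁻¹ : PowerSeries _) = 1 := by
      rw [← Units.val_mul, ← map_mul, mul_inv_cancel, map_one, Units.val_one]
    rw [hv, add_mul, one_mul, mul_assoc] at h
    rw [mul_neg, ← h]
    abel
  · rw [map_neg, map_mul, constantCoeff_expansion, mul_one]

theorem HasLead.of_succ {i : ℕ} {g : FreeGroup X} {a : FreeAlgebra ℤ X}
    (ha : HasLead (i + 1) g a) : HasLead i g 0 := by
  obtain ⟨v, hv, rfl⟩ := ha
  exact ⟨PowerSeries.X * v, by rw [hv, ← mul_assoc, ← pow_succ], by simp⟩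

theorem HasLead.pow {i : ℕ} {g : FreeGroup X} {a : FreeAlgebra ℤ X} (ha : HasLead i g a) (n : ℕ) :
    HasLead i (g ^ n) (n • a) := by
  induction n with
  | zero => simpa using HasLead.one i
  | succ n ih => rw [pow_succ, succ_nsmul]; exact ih.mul ha

theorem HasLead.commutator {i j : ℕ} {g h : FreeGroup X} {a b : FreeAlgebra ℤ X}
    (ha : HasLead i g a) (hb : HasLead j h b) : HasLead (i + j + 1) ⁅g, h⁆ ⁅a, b⁆ := by
  obtain ⟨v, hv, rfl⟩ := ha
  obtain ⟨w, hw, rfl⟩ := hb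
  set P := (expansion X g : PowerSeries (FreeAlgebra ℤ X)) with hP
  set Q := (expansion X h : PowerSeries (FreeAlgebra ℤ X)) with hQ
  set I := (expansion X (g⁻¹ * h⁻¹) : PowerSeries (FreeAlgebra ℤ X)) with hI
  refine ⟨(v * w - w * v) * I, ?_, ?_⟩
  · have h1 : (expansion X ⁅g, h⁆ : PowerSeries (FreeAlgebra ℤ X)) = P * Q * I := by
      rw [hP, hQ, hI, ← Units.val_mul, ← Units.val_mul, ← map_mul, ← map_mul, commutatorElement_def]
      simp only [mul_assoc]
    have h2 : Q * P * I = 1 := by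
      rw [hP, hQ, hI, ← Units.val_mul, ← Units.val_mul, ← map_mul, ← map_mul]
      simp [mul_assoc]
    have h3 : P * Q = Q * P + PowerSeries.X ^ (i + j + 1 + 1) * (v * w - w * v) := by
      have c1 : v * (PowerSeries.X ^ (j + 1) * w) = PowerSeries.X ^ (j + 1) * (v * w) := by
        rw [← mul_assoc, (commute_X_pow v _).eq, mul_assoc]
      have c2 : w * (PowerSeries.X ^ (i + 1) * v) = PowerSeries.X ^ (i + 1) * (w * v) := by
        rw [← mul_assoc, (commute_X_pow w _).eq, mul_assoc]
      have e1 : PowerSeries.X ^ (i + 1) * v * (PowerSeries.X ^ (j + 1) * w) =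
          PowerSeries.X ^ (i + j + 1 + 1) * (v * w) := by
        rw [mul_assoc, c1, ← mul_assoc, ← pow_add]
        congr 2; omega
      have e2 : PowerSeries.X ^ (j + 1) * w * (PowerSeries.X ^ (i + 1) * v) =
          PowerSeries.X ^ (i + j + 1 + 1) * (w * v) := by
        rw [mul_assoc, c2, ← mul_assoc, ← pow_add]
        congr 2; omega
      rw [hv, hw]
      simp only [add_mul, mul_add, one_mul, mul_one, e1, e2, mul_sub]
      abel
    rw [h1, h3, add_mul, h2, mul_assoc]
  · rw [map_mul, hI, constantCoeff_expansion, mul_one, map_sub, map_mul, map_mul]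
    rfl

/-- The Lie homomorphism from the free Lie ring to the Lie ring of the free group. -/
noncomputable def toLCSRing (X : Type u) : FreeLieAlgebra ℤ X →ₗ⁅ℤ⁆ LCSRing (FreeGroup X) :=
  FreeLieAlgebra.lift ℤ fun x => LCSRing.single 0 ⟨FreeGroup.of x, Subgroup.mem_top _⟩

/-- `l` is a Lie polynomial that represents `g`, an element of `lcs i`, both in the Lie ring of the
free group and in the Magnus expansion. In degree at least `2` it vanishes when all letters are
identified with one commuting variable. -/
structure IsSymbol (i : ℕ) (g : FreeGroup X) (l : FreeLieAlgebra ℤ X) : Prop where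
  mem : g ∈ lcs (FreeGroup X) i
  toLCSRing_eq : toLCSRing X l = LCSRing.single i ⟨g, mem⟩
  hasLead : HasLead i g (toFree ℤ X l)
  lift_X_eq_zero : 1 ≤ i →
    FreeAlgebra.lift ℤ (fun _ => (Polynomial.X : Polynomial ℤ)) (toFree ℤ X l) = 0

theorem IsSymbol.one (i : ℕ) : IsSymbol i (1 : FreeGroup X) 0 where
  mem := one_mem _
  toLCSRing_eq := by rw [map_zero]; exact (LCSRing.single_one i).symm
  hasLead := by rw [map_zero]; exact HasLead.one i
  lift_X_eq_zero _ := by rw [map_zero, map_zero]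

theorem IsSymbol.mul {i : ℕ} {g h : FreeGroup X} {l m : FreeLieAlgebra ℤ X} (hg : IsSymbol i g l)
    (hh : IsSymbol i h m) : IsSymbol i (g * h) (l + m) where
  mem := mul_mem hg.mem hh.mem
  toLCSRing_eq := by
    rw [map_add, hg.toLCSRing_eq, hh.toLCSRing_eq, ← LCSRing.single_mul]; rfl
  hasLead := by rw [map_add]; exact hg.hasLead.mul hh.hasLead
  lift_X_eq_zero hi := by
    rw [map_add, map_add, hg.lift_X_eq_zero hi, hh.lift_X_eq_zero hi, add_zero]

theorem IsSymbol.inv {i : ℕ} {g : FreeGroup X} {l : FreeLieAlgebra ℤ X} (hg : IsSymbol i g l) :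
    IsSymbol i g⁻¹ (-l) where
  mem := inv_mem hg.mem
  toLCSRing_eq := by rw [map_neg, hg.toLCSRing_eq, ← LCSRing.single_inv]; rfl
  hasLead := by rw [map_neg]; exact hg.hasLead.inv
  lift_X_eq_zero hi := by rw [map_neg, map_neg, hg.lift_X_eq_zero hi, neg_zero]

theorem IsSymbol.commutator {i j : ℕ} {g h : FreeGroup X} {l m : FreeLieAlgebra ℤ X}
    (hg : IsSymbol i g l) (hh : IsSymbol j h m) : IsSymbol (i + j + 1) ⁅g, h⁆ ⁅l, m⁆ where
  mem := commutator_mem_lcs le_rfl hg.mem hh.mem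
  toLCSRing_eq := by
    rw [LieHom.map_lie, hg.toLCSRing_eq, hh.toLCSRing_eq, LCSRing.lie_single]; rfl
  hasLead := by rw [LieHom.map_lie]; exact hg.hasLead.commutator hh.hasLead
  lift_X_eq_zero _ := by
    rw [LieHom.map_lie, LieRing.of_associative_ring_bracket, map_sub, map_mul, map_mul, mul_comm,
      sub_self]

theorem exists_isSymbol_zero (g : FreeGroup X) : ∃ l, IsSymbol 0 g l := by
  induction g using FreeGroup.induction_on with
  | C1 => exact ⟨0, IsSymbol.one 0⟩
  | of x =>
    refine ⟨FreeLieAlgebra.of ℤ x, Subgroup.mem_top _, ?_, ?_, by simp⟩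
    · exact FreeLieAlgebra.lift_of_apply _ _
    · rw [toFree_of]
      exact HasLead.of x
  | inv_of x ih =>
    obtain ⟨l, hl⟩ := ih
    exact ⟨-l, hl.inv⟩
  | mul g h ihg ihh =>
    obtain ⟨l, hl⟩ := ihg
    obtain ⟨m, hm⟩ := ihh
    exact ⟨l + m, hl.mul hm⟩

theorem exists_isSymbol {i : ℕ} {g : FreeGroup X} (hg : g ∈ lcs (FreeGroup X) i) :
    ∃ l, IsSymbol i g l := by
  induction i generalizing g with
  | zero => exact exists_isSymbol_zero g
  | succ i ih =>
    induction hg using Subgroup.closure_induction with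
    | mem g hg =>
      obtain ⟨p, hp, q, -, rfl⟩ := hg
      obtain ⟨l, hl⟩ := ih hp
      obtain ⟨m, hm⟩ := exists_isSymbol_zero q
      exact ⟨⁅l, m⁆, hl.commutator hm⟩
    | one => exact ⟨0, IsSymbol.one _⟩
    | mul g h _ _ ihg ihh =>
      obtain ⟨l, hl⟩ := ihg
      obtain ⟨m, hm⟩ := ihh
      exact ⟨l + m, hl.mul hm⟩
    | inv g _ ihg =>
      obtain ⟨l, hl⟩ := ihg
      exact ⟨-l, hl.inv⟩

/-- **Magnus–Witt theorem**: an element of `lcs i` whose Magnus expansion is trivial in degree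
`i + 1` belongs to `lcs (i + 1)`. -/
theorem mem_lcs_succ_of_hasLead_zero {i : ℕ} {g : FreeGroup X} (hg : g ∈ lcs (FreeGroup X) i)
    (h : HasLead i g 0) : g ∈ lcs (FreeGroup X) (i + 1) := by
  obtain ⟨l, hl⟩ := exists_isSymbol hg
  obtain rfl : l = 0 := toFree_injective ℤ X (by rw [hl.hasLead.unique h, map_zero])
  exact (LCSRing.single_eq_zero_iff ⟨g, hg⟩).1 (hl.toLCSRing_eq.symm.trans (map_zero _))

theorem hasLead_zero_of_mem {i j : ℕ} (hij : i < j) {g : FreeGroup X}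
    (hg : g ∈ lcs (FreeGroup X) j) : HasLead i g 0 := by
  obtain ⟨l, hl⟩ := exists_isSymbol (lcs_antitone (Nat.succ_le_of_lt hij) hg)
  exact hl.hasLead.of_succ

/-- The factors of the lower central series of a free group are torsion free. -/
theorem mem_lcs_succ_of_pow_mem {i n : ℕ} (hn : n ≠ 0) {g : FreeGroup X}
    (hg : g ∈ lcs (FreeGroup X) i) (h : g ^ n ∈ lcs (FreeGroup X) (i + 1)) :
    g ∈ lcs (FreeGroup X) (i + 1) := by
  obtain ⟨l, hl⟩ := exists_isSymbol hg
  have h0 := (hl.hasLead.pow n).unique (hasLead_zero_of_mem (Nat.lt_succ_self i) h)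
  refine mem_lcs_succ_of_hasLead_zero hg ?_
  rw [← (smul_eq_zero.1 h0).resolve_left hn]
  exact hl.hasLead

theorem mul_ι_eq_of_commutator_mem {i : ℕ} {g : FreeGroup X} {a : FreeAlgebra ℤ X} {x : X}
    (ha : HasLead i g a) (h : ⁅g, FreeGroup.of x⁆ ∈ lcs (FreeGroup X) (i + 2)) :
    a * FreeAlgebra.ι ℤ x = FreeAlgebra.ι ℤ x * a := by
  have := (ha.commutator (HasLead.of x)).unique (hasLead_zero_of_mem (by omega) h)
  rwa [LieRing.of_associative_ring_bracket, sub_eq_zero] at this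

/-- The leading term of `g` commutes with the letter `x`, hence is a polynomial in `x`; being a Lie
element of degree at least `2`, it vanishes when all letters are made to commute. -/
theorem mem_lcs_succ_of_commutator_mem {i : ℕ} (hi : 1 ≤ i) {g : FreeGroup X} {x : X}
    (hg : g ∈ lcs (FreeGroup X) i) (h : ⁅g, FreeGroup.of x⁆ ∈ lcs (FreeGroup X) (i + 2)) :
    g ∈ lcs (FreeGroup X) (i + 1) := by
  obtain ⟨l, hl⟩ := exists_isSymbol hg
  have h0 := FreeAlgebra.eq_zero_of_commute_of_lift_X_eq_zero
    (mul_ι_eq_of_commutator_mem hl.hasLead h) (hl.lift_X_eq_zero hi)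
  exact mem_lcs_succ_of_hasLead_zero hg (h0 ▸ hl.hasLead)

theorem lift_zero_toFree (l : FreeLieAlgebra ℤ X) :
    FreeAlgebra.lift ℤ (fun _ => (0 : ℤ)) (toFree ℤ X l) = 0 := by
  refine induction_of_lie_closed (fun l => FreeAlgebra.lift ℤ (fun _ => (0 : ℤ)) (toFree ℤ X l) = 0)
    ?_ ?_ ?_ ?_ ?_ l
  · simp
  · simp
  · intro a b ha hb
    simp [ha, hb]
  · intro r a ha
    rw [map_smul, map_smul, ha, smul_zero]
  · intro a b _ _
    rw [LieHom.map_lie, LieRing.of_associative_ring_bracket, map_sub, map_mul, map_mul, mul_comm,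
      sub_self]

/-- The leading term of `g` commutes with two letters, hence is a constant, and a Lie element has no
constant term. This covers elements outside the commutator subgroup as well. -/
theorem mem_lcs_succ_of_two_commutators_mem {i : ℕ} {g : FreeGroup X} {x z : X} (hxz : x ≠ z)
    (hg : g ∈ lcs (FreeGroup X) i) (hx : ⁅g, FreeGroup.of x⁆ ∈ lcs (FreeGroup X) (i + 2))
    (hz : ⁅g, FreeGroup.of z⁆ ∈ lcs (FreeGroup X) (i + 2)) : g ∈ lcs (FreeGroup X) (i + 1) := by
  obtain ⟨l, hl⟩ := exists_isSymbol hg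
  have h0 := FreeAlgebra.eq_zero_of_commute_of_commute hxz
    (mul_ι_eq_of_commutator_mem hl.hasLead hx) (mul_ι_eq_of_commutator_mem hl.hasLead hz)
    (lift_zero_toFree l)
  exact mem_lcs_succ_of_hasLead_zero hg (h0 ▸ hl.hasLead)

end Magnus

/-! ### Endomorphisms and the lower central series -/

section Endomorphisms

variable {G H : Type*} [Group G] [Group H]

theorem map_mem_lcs (e : G →* H) {i : ℕ} {g : G} (hg : g ∈ lcs G i) : e g ∈ lcs H i := by
  have h : (lcs G i).map e ≤ lcs H i := by
    rw [lcs, Subgroup.map_lowerCentralSeries]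
    exact Subgroup.lowerCentralSeries_mono i le_top
  exact h ⟨g, hg, rfl⟩

theorem lcs_one_eq_bot {A : Type*} [CommGroup A] : lcs A 1 = ⊥ := by
  rw [Subgroup.lowerCentralSeries_one_eq_bot_iff]
  infer_instance

theorem lcs_eq_bot_of_comm {A : Type*} [CommGroup A] {k : ℕ} (hk : 1 ≤ k) : lcs A k = ⊥ :=
  le_bot_iff.1 (lcs_one_eq_bot (A := A) ▸ lcs_antitone hk)

theorem map_lcs_of_surjective {f : G →* H} (hf : Function.Surjective f) (i : ℕ) :
    (lcs G i).map f = lcs H i := by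
  rw [lcs, Subgroup.map_lowerCentralSeries, Subgroup.map_top_of_surjective f hf]

/-- The restriction of a homomorphism to terms of the lower central series. -/
def lcsMap (e : G →* H) (i : ℕ) : lcs G i →* lcs H i :=
  (e.comp (lcs G i).subtype).codRestrict (lcs H i) fun g => map_mem_lcs e g.2

/-- Homomorphisms on `lcs G (i + 1)` are determined by their values on commutators. -/
theorem lcs_succ_hom_ext {A : Type*} [Group A] {i : ℕ} (Φ Ψ : lcs G (i + 1) →* A)
    (h : ∀ (p : lcs G i) (q : lcs G 0),
      Φ (LCSFactor.comm (i := i) (j := 0) p q) = Ψ (LCSFactor.comm (i := i) (j := 0) p q)) : Φ = Ψ := by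
  ext ⟨g, hg⟩
  induction hg using Subgroup.closure_induction with
  | mem g hg =>
    obtain ⟨p, hp, q, hq, rfl⟩ := hg
    exact h ⟨p, hp⟩ ⟨q, hq⟩
  | one => exact (map_one Φ).trans (map_one Ψ).symm
  | mul x y hx hy ihx ihy =>
    exact (map_mul Φ ⟨x, hx⟩ ⟨y, hy⟩).trans
      ((congrArg₂ (· * ·) ihx ihy).trans (map_mul Ψ ⟨x, hx⟩ ⟨y, hy⟩).symm)
  | inv x hx ihx =>
    exact (map_inv Φ ⟨x, hx⟩).trans ((congrArg (·⁻¹) ihx).trans (map_inv Ψ ⟨x, hx⟩).symm)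

theorem lcsMap_comm (e : G →* H) {i j : ℕ} (p : lcs G i) (q : lcs G j) :
    lcsMap e (i + j + 1) (LCSFactor.comm p q) = LCSFactor.comm (lcsMap e i p) (lcsMap e j q) :=
  Subtype.ext (map_commutatorElement e (p : G) (q : G))

theorem LCSFactor.br_pow_pow {i j : ℕ} (a : LCSFactor G i) (b : LCSFactor G j) (m n : ℕ) :
    br i j (a ^ m) (b ^ n) = br i j a b ^ (m * n) := by
  have h1 : br i j (a ^ m) = br i j a ^ m := map_pow _ a m
  have h2 : br i j a (b ^ n) = br i j a b ^ n := map_pow _ b n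
  rw [h1, MonoidHom.pow_apply, h2, ← pow_mul, mul_comm]

open LCSFactor in
theorem cls_lcsMap_comm_eq_pow (e : G →* G) {i j m n : ℕ} {p : lcs G i} {q : lcs G j}
    (hp : cls i (lcsMap e i p) = cls i p ^ m) (hq : cls j (lcsMap e j q) = cls j q ^ n) :
    cls (i + j + 1) (lcsMap e (i + j + 1) (comm p q)) = cls (i + j + 1) (comm p q) ^ (m * n) := by
  rw [lcsMap_comm, ← br_cls, hp, hq, br_pow_pow, br_cls]

open LCSFactor in
/-- An endomorphism that is the `n`-th power on the abelianization is the `n ^ (i + 1)`-th power on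
the factor of `lcs G i`. -/
theorem cls_lcsMap_eq_pow {e : G →* G} {n : ℕ} (h : ∀ g, (g ^ n)⁻¹ * e g ∈ lcs G 1) (i : ℕ)
    (g : lcs G i) : cls i (lcsMap e i g) = cls i g ^ n ^ (i + 1) := by
  have h0 : ∀ g : lcs G 0, cls 0 (lcsMap e 0 g) = cls 0 g ^ n := fun g => by
    rw [← map_pow, eq_comm, cls_eq_cls_iff]
    exact h g
  induction i with
  | zero => exact (h0 g).trans (congrArg (cls 0 g ^ ·) (pow_one n).symm)
  | succ i ih =>
    let Ψ : lcs G (i + 1) →* LCSFactor G (i + 1) :=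
      MonoidHom.mk' (fun g => cls (i + 1) g ^ n ^ (i + 1 + 1)) fun a b => by
        rw [map_mul, mul_pow]
    have key : (cls (i + 1)).comp (lcsMap e (i + 1)) = Ψ :=  by
      refine lcs_succ_hom_ext _ _ fun p q => ?_
      have h1 := cls_lcsMap_comm_eq_pow e (i := i) (j := 0) (ih p) (h0 q)
      rw [← pow_succ] at h1
      exact h1
    have := DFunLike.congr_fun key g
    exact this

theorem pow_inv_mul_map_mem_lcs {e : G →* G} {n : ℕ} (h : ∀ g, (g ^ n)⁻¹ * e g ∈ lcs G 1) {i : ℕ}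
    {g : G} (hg : g ∈ lcs G i) : (g ^ n ^ (i + 1))⁻¹ * e g ∈ lcs G (i + 1) := by
  have := cls_lcsMap_eq_pow h i ⟨g, hg⟩
  rw [← map_pow, eq_comm, LCSFactor.cls_eq_cls_iff] at this
  exact this

theorem inv_mul_map_mem_lcs {e : G →* G} (h : ∀ g, g⁻¹ * e g ∈ lcs G 1) {i : ℕ} {g : G}
    (hg : g ∈ lcs G i) : g⁻¹ * e g ∈ lcs G (i + 1) := by
  have := pow_inv_mul_map_mem_lcs (n := 1) (by simpa using h) hg
  simpa using this

/-- An endomorphism of a nilpotent group that is trivial on the abelianization is bijective. -/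
theorem bijective_of_inv_mul_map_mem {c : ℕ} (hc : lcs G c = ⊥) {e : G →* G}
    (h : ∀ g, g⁻¹ * e g ∈ lcs G 1) : Function.Bijective e := by
  constructor
  · rw [injective_iff_map_eq_one]
    intro g hg
    have key : ∀ i, g ∈ lcs G i := fun i => by
      induction i with
      | zero => exact Subgroup.mem_top g
      | succ i ih =>
        have := inv_mul_map_mem_lcs h ih
        rw [hg, mul_one] at this
        exact inv_mem_iff.1 this
    have := key c
    rwa [hc, Subgroup.mem_bot] at this
  · have key : ∀ j i, i + j = c → lcs G i ≤ e.range := fun j => by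
      induction j with
      | zero =>
        intro i hi
        rw [add_zero] at hi
        rw [hi, hc]
        exact bot_le
      | succ j ih =>
        intro i hi g hg
        have h1 := ih (i + 1) (by omega) (inv_mul_map_mem_lcs h hg)
        have h2 : g = e g * (g⁻¹ * e g)⁻¹ := by group
        rw [h2]
        exact mul_mem ⟨g, rfl⟩ (inv_mem h1)
    intro g
    exact key c 0 (by omega) (Subgroup.mem_top g)

end Endomorphisms

/-! ### Bases of free nilpotent groups -/

/-- The indexed form of `IsFreeNilpotentBasis`: the family `v` identifies `G` with
`F(ι) / γ_{c+1}(F(ι))`. -/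
structure IsFreeNilpotentFamily (c : ℕ) {ι G : Type*} [Group G] (v : ι → G) : Prop where
  surjective : Function.Surjective (FreeGroup.lift v)
  ker_eq : (FreeGroup.lift v).ker = lcs (FreeGroup ι) c

theorem isFreeNilpotentBasis_iff {c : ℕ} {G : Type*} [Group G] {X : Set G} :
    IsFreeNilpotentBasis c X ↔ IsFreeNilpotentFamily c (fun x : X => (x : G)) :=
  ⟨fun h => ⟨h.1, h.2⟩, fun h => ⟨h.1, h.2⟩⟩

namespace IsFreeNilpotentFamily

variable {c : ℕ} {ι G M : Type*} [Group G] [Group M] {v : ι → G}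

theorem lcs_eq_bot (hv : IsFreeNilpotentFamily c v) : lcs G c = ⊥ := by
  rw [← map_lcs_of_surjective hv.surjective, ← hv.ker_eq, Subgroup.map_eq_bot_iff]

theorem hom_ext (hv : IsFreeNilpotentFamily c v) {f g : G →* M} (h : ∀ i, f (v i) = g (v i)) :
    f = g := by
  have h1 : f.comp (FreeGroup.lift v) = g.comp (FreeGroup.lift v) := by
    ext i
    simp [h]
  ext x
  obtain ⟨y, rfl⟩ := hv.surjective x
  exact DFunLike.congr_fun h1 y

/-- The homomorphism to a nilpotent group of class at most `c` with prescribed values on a basis. -/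
noncomputable def extend (hv : IsFreeNilpotentFamily c v) (hM : lcs M c = ⊥) (w : ι → M) : G →* M :=
  (FreeGroup.lift v).liftOfSurjective hv.surjective ⟨FreeGroup.lift w, fun g hg => by
    rw [hv.ker_eq] at hg
    have := map_mem_lcs (FreeGroup.lift w) hg
    rwa [hM, Subgroup.mem_bot] at this⟩

theorem extend_lift (hv : IsFreeNilpotentFamily c v) (hM : lcs M c = ⊥) (w : ι → M)
    (g : FreeGroup ι) : hv.extend hM w (FreeGroup.lift v g) = FreeGroup.lift w g :=
  MonoidHom.liftOfRightInverse_comp_apply _ _ _ _ _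

@[simp] theorem extend_apply (hv : IsFreeNilpotentFamily c v) (hM : lcs M c = ⊥) (w : ι → M)
    (i : ι) : hv.extend hM w (v i) = w i := by
  have := hv.extend_lift hM w (FreeGroup.of i)
  simpa using this

theorem lift_mem_lcs_iff (hv : IsFreeNilpotentFamily c v) {i : ℕ} (hi : i ≤ c) (g : FreeGroup ι) :
    FreeGroup.lift v g ∈ lcs G i ↔ g ∈ lcs (FreeGroup ι) i := by
  refine ⟨fun h => ?_, map_mem_lcs _⟩
  rw [← map_lcs_of_surjective hv.surjective] at h
  obtain ⟨g', hg', e⟩ := h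
  have h1 : g'⁻¹ * g ∈ (FreeGroup.lift v).ker := by
    rw [MonoidHom.mem_ker, map_mul, map_inv, e, inv_mul_cancel]
  rw [hv.ker_eq] at h1
  simpa using mul_mem hg' (lcs_antitone hi h1)

theorem injective (hv : IsFreeNilpotentFamily c v) (hc : 1 ≤ c) : Function.Injective v := by
  classical
  intro i j hij
  have h1 : FreeGroup.lift v (FreeGroup.of i * (FreeGroup.of j)⁻¹) ∈ lcs G 1 := by
    simp [hij, one_mem]
  rw [hv.lift_mem_lcs_iff hc] at h1
  by_contra hne
  have h2 := map_mem_lcs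
    (FreeGroup.lift fun k => Multiplicative.ofAdd (if k = i then (1 : ℤ) else 0)) h1
  rw [lcs_one_eq_bot, Subgroup.mem_bot] at h2
  simp [Ne.symm hne] at h2

theorem mem_lcs_of_forall_commutator (hv : IsFreeNilpotentFamily c v) [Nontrivial ι] {d : ℕ}
    (hd : d + 1 ≤ c) {a : G} (h : ∀ z, ⁅a, z⁆ ∈ lcs G (d + 1)) : a ∈ lcs G d := by
  obtain ⟨x, z, hxz⟩ := exists_pair_ne ι
  obtain ⟨a, rfl⟩ := hv.surjective a
  have hF : ∀ y : ι, ⁅a, FreeGroup.of y⁆ ∈ lcs (FreeGroup ι) (d + 1) := fun y => by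
    rw [← hv.lift_mem_lcs_iff hd, map_commutatorElement]
    exact h _
  suffices key : ∀ i ≤ d, a ∈ lcs (FreeGroup ι) i from map_mem_lcs _ (key d le_rfl)
  intro i hi
  induction i with
  | zero => exact Subgroup.mem_top a
  | succ i ih =>
    exact Magnus.mem_lcs_succ_of_two_commutators_mem hxz (ih (by omega))
      (lcs_antitone (by omega) (hF x)) (lcs_antitone (by omega) (hF z))

theorem mem_lcs_succ_of_commutator_eq_one (hv : IsFreeNilpotentFamily c v) {i : ℕ} (hi : 1 ≤ i)
    (hc : i + 2 = c) {b : G} (hb : b ∈ lcs G i) {x : ι} (h : ⁅b, v x⁆ = 1) :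
    b ∈ lcs G (i + 1) := by
  obtain ⟨b, rfl⟩ := hv.surjective b
  rw [hv.lift_mem_lcs_iff (by omega)] at hb ⊢
  refine Magnus.mem_lcs_succ_of_commutator_mem (x := x) hi hb ?_
  rw [← hv.lift_mem_lcs_iff hc.le, map_commutatorElement, FreeGroup.lift_apply_of, h]
  exact one_mem _

theorem eq_one_of_pow_eq_one (hv : IsFreeNilpotentFamily c v) {i n : ℕ} (hn : n ≠ 0)
    (hc : i + 1 = c) {a : G} (ha : a ∈ lcs G i) (h : a ^ n = 1) : a = 1 := by
  obtain ⟨a, rfl⟩ := hv.surjective a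
  rw [hv.lift_mem_lcs_iff (by omega)] at ha
  have h1 := Magnus.mem_lcs_succ_of_pow_mem hn ha (by
    rw [hc, ← hv.ker_eq, MonoidHom.mem_ker, map_pow, h])
  rwa [hc, ← hv.ker_eq, MonoidHom.mem_ker] at h1

/-- A family congruent to a basis modulo the commutator subgroup is a basis. -/
theorem of_congr (hv : IsFreeNilpotentFamily c v) {w : ι → G}
    (h : ∀ i, (v i)⁻¹ * w i ∈ lcs G 1) : IsFreeNilpotentFamily c w := by
  set e := hv.extend hv.lcs_eq_bot w with he
  have h1 : (QuotientGroup.mk' (lcs G 1)).comp e = QuotientGroup.mk' (lcs G 1) := by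
    refine hv.hom_ext fun i => ?_
    rw [MonoidHom.comp_apply, he, extend_apply]
    exact (QuotientGroup.eq.2 (h i)).symm
  have hb := bijective_of_inv_mul_map_mem hv.lcs_eq_bot (e := e) fun g =>
    QuotientGroup.eq.1 (DFunLike.congr_fun h1 g).symm
  have e1 : FreeGroup.lift w = e.comp (FreeGroup.lift v) := by
    ext i
    simp [he]
  refine ⟨?_, ?_⟩
  · rw [e1]
    exact hb.2.comp hv.surjective
  · rw [e1, ← MonoidHom.comap_ker, (MonoidHom.ker_eq_bot_iff e).2 hb.1, MonoidHom.comap_bot,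
      hv.ker_eq]

theorem quotient (hv : IsFreeNilpotentFamily c v) {d : ℕ} (hd : d ≤ c) :
    IsFreeNilpotentFamily d fun i => (v i : G ⧸ lcs G d) := by
  have e : (FreeGroup.lift fun i => (v i : G ⧸ lcs G d)) =
      (QuotientGroup.mk' (lcs G d)).comp (FreeGroup.lift v) := by
    ext i
    simp
  refine ⟨?_, ?_⟩
  · rw [e]
    exact (QuotientGroup.mk'_surjective _).comp hv.surjective
  · rw [e, ← MonoidHom.comap_ker, QuotientGroup.ker_mk']
    ext g
    exact hv.lift_mem_lcs_iff hd g

/-- Any lift of a basis of `G / lcs G d` is a basis of `G`. -/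
theorem of_quotient (hv : IsFreeNilpotentFamily c v) {d : ℕ} (hd : 1 ≤ d)
    {κ : Type*} {w : κ → G}
    (hw : IsFreeNilpotentFamily d fun k => (w k : G ⧸ lcs G d)) : IsFreeNilpotentFamily c w := by
  let H := FreeGroup κ ⧸ lcs (FreeGroup κ) c
  let q : FreeGroup κ →* H := QuotientGroup.mk' _
  have hH : lcs H c = ⊥ := by
    rw [← map_lcs_of_surjective (QuotientGroup.mk'_surjective _), Subgroup.map_eq_bot_iff,
      QuotientGroup.ker_mk']
  let r : G →* G ⧸ lcs G d := QuotientGroup.mk' _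
  let φ : H →* G := QuotientGroup.lift _ (FreeGroup.lift w) fun g hg => by
    have := map_mem_lcs (FreeGroup.lift w) hg
    rwa [hv.lcs_eq_bot, Subgroup.mem_bot] at this
  have hφq : ∀ g, φ (q g) = FreeGroup.lift w g := fun g => rfl
  have hrw : ∀ g, r (FreeGroup.lift w g) = FreeGroup.lift (fun k => (w k : G ⧸ lcs G d)) g := by
    intro g
    have : r.comp (FreeGroup.lift w) = FreeGroup.lift fun k => (w k : G ⧸ lcs G d) := by
      ext k
      simp [r]
    exact DFunLike.congr_fun this g
  choose f hf using fun i => hw.surjective (v i : G ⧸ lcs G d)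
  let ψ : G →* H := hv.extend hH fun i => q (f i)
  have h1 : (r.comp φ).comp ψ = r := hv.hom_ext fun i => by
    simp only [MonoidHom.comp_apply, ψ, extend_apply, hφq, hrw, hf]
    rfl
  have hφψ : Function.Bijective (φ.comp ψ) :=
    bijective_of_inv_mul_map_mem hv.lcs_eq_bot fun g =>
      lcs_antitone hd (QuotientGroup.eq.1 (DFunLike.congr_fun h1 g).symm)
  have h2 : ∀ h : H, r (φ h) = 1 → h ∈ lcs H d := fun h hh => by
    obtain ⟨g, rfl⟩ := QuotientGroup.mk'_surjective _ h
    change r (φ (q g)) = 1 at hh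
    rw [hφq, hrw, ← MonoidHom.mem_ker, hw.ker_eq] at hh
    exact map_mem_lcs q hh
  have hψφ : Function.Bijective (ψ.comp φ) :=
    bijective_of_inv_mul_map_mem hH fun h => by
      refine lcs_antitone hd (h2 _ ?_)
      have := DFunLike.congr_fun h1 (φ h)
      simp only [MonoidHom.comp_apply] at this
      rw [map_mul, map_mul, map_inv, map_inv, MonoidHom.comp_apply, this, inv_mul_cancel]
  have hinj : Function.Injective φ := hψφ.1.of_comp (f := ψ)
  have hsurj : Function.Surjective φ := fun g => by
    obtain ⟨x, hx⟩ := hφψ.2 g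
    exact ⟨ψ x, hx⟩
  have e : FreeGroup.lift w = φ.comp q := by
    ext k
    simp [hφq]
  refine ⟨?_, ?_⟩
  · rw [e]
    exact hsurj.comp (QuotientGroup.mk'_surjective _)
  · rw [e, ← MonoidHom.comap_ker, (MonoidHom.ker_eq_bot_iff φ).2 hinj, MonoidHom.comap_bot]
    exact QuotientGroup.ker_mk' _

theorem isFreeNilpotentBasis_range (hv : IsFreeNilpotentFamily c v) (hc : 1 ≤ c) :
    IsFreeNilpotentBasis c (Set.range v) := by
  let E := FreeGroup.freeGroupCongr (Equiv.ofInjective v (hv.injective hc))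
  have e : (FreeGroup.lift v) = (FreeGroup.lift fun x : Set.range v => (x : G)).comp E.toMonoidHom := by
    ext i
    simp [E]
  rw [isFreeNilpotentBasis_iff]
  refine ⟨?_, ?_⟩
  · have := hv.surjective
    rw [e] at this
    exact Function.Surjective.of_comp this
  · have h1 := hv.ker_eq
    rw [e, ← MonoidHom.comap_ker] at h1
    rw [← Subgroup.map_comap_eq_self_of_surjective E.surjective (MonoidHom.ker _)]
    refine (congrArg (Subgroup.map E.toMonoidHom) h1).trans ?_
    exact map_lcs_of_surjective E.surjective c

theorem isPrimitiveElement (hv : IsFreeNilpotentFamily c v) (hc : 1 ≤ c) (i : ι) :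
    IsPrimitiveElement c (v i) :=
  ⟨Set.range v, hv.isFreeNilpotentBasis_range hc, i, rfl⟩

theorem infinite (hv : IsFreeNilpotentFamily c v) (h : ¬ Group.FG G) : Infinite ι := by
  by_contra hι
  rw [not_infinite_iff_finite] at hι
  exact h (Group.fg_of_surjective hv.surjective)

end IsFreeNilpotentFamily

/-! ### Supports and automorphisms given on a basis -/

namespace IsFreeNilpotentFamily

variable {c : ℕ} {ι N M : Type*} [Group N] [Group M] {v : ι → N}

theorem exists_finset_mem_closure (hv : IsFreeNilpotentFamily c v) (g : N) :
    ∃ S : Finset ι, g ∈ Subgroup.closure (v '' S) := by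
  classical
  obtain ⟨g, rfl⟩ := hv.surjective g
  induction g using FreeGroup.induction_on with
  | C1 => exact ⟨∅, by rw [map_one]; exact one_mem _⟩
  | of i => exact ⟨{i}, Subgroup.subset_closure (by simp)⟩
  | inv_of i h => exact ⟨{i}, by rw [map_inv]; exact inv_mem (Subgroup.subset_closure (by simp))⟩
  | mul g h ihg ihh =>
    obtain ⟨S, hS⟩ := ihg
    obtain ⟨T, hT⟩ := ihh
    refine ⟨S ∪ T, ?_⟩
    rw [map_mul]
    exact mul_mem (Subgroup.closure_mono (Set.image_mono (by simp)) hS)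
      (Subgroup.closure_mono (Set.image_mono (by simp)) hT)

theorem _root_.MonoidHom.eq_of_mem_closure_image {S : Set ι} {g : N}
    (hg : g ∈ Subgroup.closure (v '' S)) {φ ψ : N →* M} (h : ∀ i ∈ S, φ (v i) = ψ (v i)) :
    φ g = ψ g :=
  MonoidHom.eqOn_closure (by rintro _ ⟨i, hi, rfl⟩; exact h i hi) hg

/-- A power of a basis element that lies in the commutator subgroup is trivial. -/
theorem eq_one_of_mem_zpowers (hv : IsFreeNilpotentFamily c v) (hc : 1 ≤ c) {i : ι} {g : N}
    (hg : g ∈ Subgroup.zpowers (v i)) (h1 : g ∈ lcs N 1) : g = 1 := by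
  obtain ⟨k, rfl⟩ := hg
  have h2 := map_mem_lcs (hv.extend (lcs_eq_bot_of_comm hc)
    fun _ => Multiplicative.ofAdd (1 : ℤ)) h1
  rw [lcs_one_eq_bot, Subgroup.mem_bot, map_zpow, extend_apply, ← ofAdd_zsmul, ofAdd_eq_one] at h2
  have : k = 0 := by simpa using h2
  simp [this]

theorem exists_mulAut (hv : IsFreeNilpotentFamily c v) (w w' : ι → N)
    (h1 : ∀ i, hv.extend hv.lcs_eq_bot w (w' i) = v i)
    (h2 : ∀ i, hv.extend hv.lcs_eq_bot w' (w i) = v i) :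
    ∃ α : MulAut N, (∀ i, α (v i) = w i) ∧ ∀ i, α⁻¹ (v i) = w' i :=
  ⟨MonoidHom.toMulEquiv (hv.extend hv.lcs_eq_bot w) (hv.extend hv.lcs_eq_bot w')
    (hv.hom_ext (by simp [h2])) (hv.hom_ext (by simp [h1])), hv.extend_apply hv.lcs_eq_bot w,
    hv.extend_apply hv.lcs_eq_bot w'⟩

open Classical in
theorem exists_swap (hv : IsFreeNilpotentFamily c v) (y t : ι) :
    ∃ α : MulAut N, (∀ i, α (v i) = v (Equiv.swap y t i)) ∧
      ∀ i, α⁻¹ (v i) = v (Equiv.swap y t i) :=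
  hv.exists_mulAut _ _ (by simp) (by simp)

open Classical in
theorem exists_transvection (hv : IsFreeNilpotentFamily c v) {y t : ι} (h : t ≠ y) :
    ∃ α : MulAut N, α (v y) = v y * v t ∧ (∀ i, i ≠ y → α (v i) = v i) ∧
      ∀ i, i ≠ y → α⁻¹ (v i) = v i := by
  obtain ⟨α, h1, h2⟩ := hv.exists_mulAut (Function.update v y (v y * v t))
    (Function.update v y (v y * (v t)⁻¹))
    (fun i => by by_cases hi : i = y <;> simp [hi, h])
    (fun i => by by_cases hi : i = y <;> simp [hi, h])
  refine ⟨α, by simp [h1], fun i hi => by simp [h1, hi], fun i hi => by simp [h2, hi]⟩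

open Classical in
/-- The endomorphism that sends the basis elements with index in `T` to `1` and fixes the others. -/
noncomputable def erase (hv : IsFreeNilpotentFamily c v) (T : Set ι) : N →* N :=
  hv.extend hv.lcs_eq_bot fun i => if i ∈ T then 1 else v i

theorem erase_of_mem (hv : IsFreeNilpotentFamily c v) {T : Set ι} {i : ι} (h : i ∈ T) :
    hv.erase T (v i) = 1 := by
  simp [erase, h]

theorem erase_of_notMem (hv : IsFreeNilpotentFamily c v) {T : Set ι} {i : ι} (h : i ∉ T) :
    hv.erase T (v i) = v i := by
  simp [erase, h]

theorem erase_empty (hv : IsFreeNilpotentFamily c v) : hv.erase ∅ = MonoidHom.id N :=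
  hv.hom_ext fun _ => hv.erase_of_notMem (Set.notMem_empty _)

theorem erase_insert (hv : IsFreeNilpotentFamily c v) (y : ι) (T : Set ι) :
    hv.erase (insert y T) = (hv.erase T).comp (hv.erase {y}) := by
  classical
  refine hv.hom_ext fun i => ?_
  by_cases h1 : i = y <;> by_cases h2 : i ∈ T <;> simp [erase, h1, h2]

end IsFreeNilpotentFamily

/-! ### Automorphisms that are conjugations modulo the last term of the series -/

/-- `σ` is conjugation by `x` twisted by the multiplicative map `f` with values in `lcs N k`. -/
structure IsTwist {N : Type*} [Group N] (k : ℕ) (x : N) (f : N → N) (σ : MulAut N) : Prop where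
  mem : ∀ g, f g ∈ lcs N k
  map_mul : ∀ g h, f (g * h) = f g * f h
  apply : ∀ g, σ g = x * g * x⁻¹ * f g

theorem commute_of_mem_lcs {N : Type*} [Group N] {k : ℕ} (hk : lcs N (k + 1) = ⊥) {a : N}
    (ha : a ∈ lcs N k) (g : N) : Commute a g := by
  rw [← commutatorElement_eq_one_iff_commute, ← Subgroup.mem_bot, ← hk]
  exact Subgroup.commutator_mem_commutator ha (Subgroup.mem_top g)

theorem commutatorElement_mul_left_of_commute {N : Type*} [Group N] {a b g : N}
    (h : Commute ⁅b, g⁆ a) : ⁅a * b, g⁆ = ⁅b, g⁆ * ⁅a, g⁆ := by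
  rw [commutatorElement_mul_left_eq_conj_mul, ← h.eq, mul_inv_cancel_right]

namespace IsTwist

variable {N : Type*} [Group N] {k : ℕ} {x y : N} {f h : N → N} {σ τ : MulAut N}

/-- The twisting map, as a homomorphism. -/
def hom (hf : IsTwist k x f σ) : N →* N := MonoidHom.mk' f hf.map_mul

@[simp] theorem hom_apply (hf : IsTwist k x f σ) (g : N) : hf.hom g = f g := rfl

theorem map_eq_one_of_mem (hf : IsTwist k x f σ) (hk : lcs N (k + 1) = ⊥) {g : N}
    (hg : g ∈ lcs N 1) : f g = 1 := by
  have h1 : lcs N 1 ≤ hf.hom.ker := by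
    refine Subgroup.commutator_le.2 fun a _ b _ => ?_
    rw [MonoidHom.mem_ker, map_commutatorElement, commutatorElement_eq_one_iff_commute]
    exact commute_of_mem_lcs hk (hf.mem a) _
  exact h1 hg

theorem map_inv (hf : IsTwist k x f σ) (g : N) : f g⁻¹ = (f g)⁻¹ := _root_.map_inv hf.hom g

theorem map_conj (hf : IsTwist k x f σ) (hk : lcs N (k + 1) = ⊥) (a g : N) :
    f (a * g * a⁻¹) = f g := by
  rw [hf.map_mul, hf.map_mul, hf.map_inv, (commute_of_mem_lcs hk (hf.mem a) _).eq,
    mul_inv_cancel_right]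

theorem map_eq_one_of_range (hf : IsTwist k x f σ) (hk : lcs N (k + 1) = ⊥) (hk1 : 1 ≤ k) {g : N}
    (hg : g ∈ lcs N k) : f g = 1 :=
  hf.map_eq_one_of_mem hk (lcs_antitone hk1 hg)

protected theorem mul (hf : IsTwist k x f σ) (hh : IsTwist k y h τ) (hk : lcs N (k + 1) = ⊥)
    (hk1 : 1 ≤ k) : IsTwist k (x * y) (fun g => f g * h g) (σ * τ) where
  mem g := mul_mem (hf.mem g) (hh.mem g)
  map_mul a b := by
    rw [hf.map_mul, hh.map_mul, mul_assoc, mul_assoc,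
      (commute_of_mem_lcs hk (hf.mem b) (h a * h b)).eq, mul_assoc,
      (commute_of_mem_lcs hk (hf.mem b) (h b)).eq]
  apply g := by
    have c1 := (commute_of_mem_lcs hk (hh.mem g) x⁻¹).eq
    rw [MulAut.mul_apply, hh.apply, hf.apply, hf.map_mul, hf.map_conj hk,
      hf.map_eq_one_of_range hk hk1 (hh.mem g), mul_one, mul_inv_rev,
      (commute_of_mem_lcs hk (hf.mem g) (h g)).eq]
    simp only [mul_assoc]
    rw [← mul_assoc (h g) x⁻¹, c1, mul_assoc]

protected theorem inv (hf : IsTwist k x f σ) (hk : lcs N (k + 1) = ⊥)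
    (hk1 : 1 ≤ k) : IsTwist k x⁻¹ (fun g => (f g)⁻¹) σ⁻¹ where
  mem g := inv_mem (hf.mem g)
  map_mul a b := by
    rw [hf.map_mul, (commute_of_mem_lcs hk (hf.mem a) _).eq, mul_inv_rev]
  apply g := by
    rw [MulAut.inv_apply, MulEquiv.symm_apply_eq, hf.apply, hf.map_mul, hf.map_conj hk, hf.map_inv,
      hf.map_eq_one_of_range hk hk1 (hf.mem g), inv_one, mul_one]
    have c1 := (commute_of_mem_lcs hk (inv_mem (hf.mem g)) x⁻¹).eq
    simp only [mul_assoc]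
    rw [← mul_assoc (f g)⁻¹, c1]
    simp [mul_assoc]

protected theorem conj (hf : IsTwist k x f σ) (α : MulAut N) :
    IsTwist k (α x) (fun g => α (f (α⁻¹ g))) (α * σ * α⁻¹) where
  mem g := map_mem_lcs α.toMonoidHom (hf.mem _)
  map_mul a b := by rw [_root_.map_mul, hf.map_mul, _root_.map_mul]
  apply g := by
    rw [MulAut.mul_apply, MulAut.mul_apply, hf.apply, _root_.map_mul, _root_.map_mul,
      _root_.map_mul, _root_.map_inv, MulAut.apply_inv_self]

/-- The commutator with an element of the preceding term of the series can be moved between the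
conjugating element and the twisting map. -/
theorem absorb {k : ℕ} (hf : IsTwist (k + 1) x f σ) (hk : lcs N (k + 1 + 1) = ⊥) {b : N}
    (hb : b ∈ lcs N k) : IsTwist (k + 1) (x * b) (fun g => f g * ⁅b, g⁆⁻¹) σ := by
  have hm : ∀ g, ⁅b, g⁆ ∈ lcs N (k + 1) := fun g =>
    Subgroup.commutator_mem_commutator hb (Subgroup.mem_top g)
  have hc := fun g => commute_of_mem_lcs hk (hm g)
  refine ⟨fun g => mul_mem (hf.mem g) (inv_mem (hm g)), fun g h => ?_, fun g => ?_⟩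
  · have e : ⁅b, g * h⁆ = ⁅b, g⁆ * ⁅b, h⁆ := by
      rw [commutatorElement_mul_right_eq_mul_conj, mul_assoc, mul_assoc, ← mul_assoc g,
        ← (hc h g).eq, mul_inv_cancel_right]
    rw [e, hf.map_mul, mul_inv_rev, mul_assoc (f g), ← mul_assoc (f h),
      ← (hc g (f h * ⁅b, h⁆⁻¹)).inv_left.eq, mul_assoc (f g)]
  · have e : x * b * g * (x * b)⁻¹ = ⁅b, g⁆ * (x * g * x⁻¹) := by
      rw [← mul_assoc, ← mul_assoc, (hc g x).eq, commutatorElement_def]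
      group
    rw [hf.apply, e, mul_assoc ⁅b, g⁆, (hc g _).eq, ← mul_assoc _ (f g), inv_mul_cancel_right]

end IsTwist

/-! ### Twists whose normal closure meets the central automorphisms in inner ones -/

/-- Every element of the normal closure of `σ` that is trivial modulo `lcs N (k + 1)` is the
conjugation by an element of `lcs N k`. -/
def NormalClosureInner {N : Type*} [Group N] (k : ℕ) (σ : MulAut N) : Prop :=
  ∀ τ ∈ Subgroup.normalClosure {σ}, ∀ h, IsTwist (k + 1) 1 h τ →
    ∃ a ∈ lcs N k, ∀ g, h g = ⁅a, g⁆

namespace IsTwist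

variable {N ι : Type*} [Group N] {k : ℕ} {x : N} {v : ι → N} {x₀ : ι} {f : N → N} {σ : MulAut N}

theorem conj_mem_normalClosure (α σ : MulAut N) :
    α * σ * α⁻¹ ∈ Subgroup.normalClosure {σ} :=
  Subgroup.normalClosure_normal.conj_mem _ (Subgroup.subset_normalClosure (Set.mem_singleton σ)) α

/-- The commutator of `α` and `σ` lies in the normal closure of `σ`, and is trivial modulo the last
term of the series when `α` fixes `x`. -/
theorem exists_commutator_of_map_eq (hf : IsTwist (k + 1) x f σ) (hk : lcs N (k + 1 + 1) = ⊥)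
    (hσ : NormalClosureInner k σ) {α : MulAut N} (hα : α x = x) :
    ∃ a ∈ lcs N k, ∀ g, α (f (α⁻¹ g)) * (f g)⁻¹ = ⁅a, g⁆ := by
  have h := (hf.conj α).mul (hf.inv hk (by omega)) hk (by omega)
  rw [hα, mul_inv_cancel] at h
  exact hσ _ (mul_mem (conj_mem_normalClosure α σ)
    (inv_mem (Subgroup.subset_normalClosure (Set.mem_singleton σ)))) _ h

open Classical in
/-- A transposition of `v y` with an unused `v t` removes `v y` from the word `g`. -/
theorem erase_swap {c : ℕ} (hv : IsFreeNilpotentFamily c v) {S : Set ι} {y t : ι} (hty : t ≠ y)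
    (htS : t ∉ S) {α : MulAut N} (hα : ∀ i, α (v i) = v (Equiv.swap y t i)) {g : N}
    (hg : g ∈ Subgroup.closure (v '' S)) : hv.erase {y} (α g) = α g := by
  refine MonoidHom.eq_of_mem_closure_image (φ := (hv.erase {y}).comp α.toMonoidHom)
    (ψ := α.toMonoidHom) hg fun i hi => ?_
  change hv.erase {y} (α (v i)) = α (v i)
  rw [hα]
  refine hv.erase_of_notMem ?_
  rw [Set.mem_singleton_iff, Equiv.swap_apply_eq_iff, Equiv.swap_apply_left]
  rintro rfl
  exact htS hi

/-- Comparing `σ` with its conjugates under transpositions of the basis removes, one basis element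
at a time, everything except `v x₀` from `f (v x₀)`, at the cost of a commutator with `v x₀`. -/
theorem exists_commutator_mul_erase [Infinite ι] (hv : IsFreeNilpotentFamily (k + 2) v)
    (hf : IsTwist (k + 1) (v x₀) f σ) (hσ : NormalClosureInner k σ) (T : Finset ι) (hT : x₀ ∉ T) :
    ∃ b ∈ lcs N k, f (v x₀) = ⁅b, v x₀⁆ * hv.erase T (f (v x₀)) := by
  classical
  have hk := hv.lcs_eq_bot
  obtain ⟨S, hS⟩ := hv.exists_finset_mem_closure (f (v x₀))
  induction T using Finset.induction_on with
  | empty => exact ⟨1, one_mem _, by simp [hv.erase_empty]⟩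
  | insert y T hy ih =>
    rw [Finset.mem_insert, not_or] at hT
    obtain ⟨b, hb, hbf⟩ := ih hT.2
    obtain ⟨t, ht⟩ := Infinite.exists_notMem_finset (insert x₀ (insert y S))
    simp only [Finset.mem_insert, not_or] at ht
    obtain ⟨α, h1, h2⟩ := hv.exists_swap y t
    have hαx : α (v x₀) = v x₀ := by
      rw [h1, Equiv.swap_apply_of_ne_of_ne hT.1 (Ne.symm ht.1)]
    have hαx' : α⁻¹ (v x₀) = v x₀ := by
      rw [h2, Equiv.swap_apply_of_ne_of_ne hT.1 (Ne.symm ht.1)]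
    obtain ⟨a, ha, haf⟩ := hf.exists_commutator_of_map_eq hk hσ hαx
    have e1 := haf (v x₀)
    rw [hαx', mul_inv_eq_iff_eq_mul] at e1
    have hyx : hv.erase {y} (v x₀) = v x₀ := hv.erase_of_notMem hT.1
    have e2 := congrArg (hv.erase {y}) e1
    rw [erase_swap hv ht.2.1 ht.2.2 h1 hS, _root_.map_mul, map_commutatorElement, hyx] at e2
    have e3 : α⁻¹ (hv.erase {y} (f (v x₀))) = hv.erase {y} (f (v x₀)) := by
      refine MonoidHom.eq_of_mem_closure_image
        (φ := (α⁻¹ : MulAut N).toMonoidHom.comp (hv.erase {y})) hS fun i hi => ?_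
      change α⁻¹ (hv.erase {y} (v i)) = hv.erase {y} (v i)
      by_cases hiy : i = y
      · rw [hv.erase_of_mem (by simp [hiy]), map_one]
      · rw [hv.erase_of_notMem (by simpa using hiy), h2, Equiv.swap_apply_of_ne_of_ne hiy]
        rintro rfl
        exact ht.2.2 hi
    have e4 := (MulAut.inv_apply_self N α (f (v x₀))).symm.trans (congrArg (α⁻¹ : MulAut N) e2)
    rw [_root_.map_mul, map_commutatorElement, hαx', e3] at e4
    have e5 := congrArg (hv.erase T) e4
    have hTx : hv.erase T (v x₀) = v x₀ := hv.erase_of_notMem (by simpa using hT.2)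
    rw [_root_.map_mul, map_commutatorElement, hTx] at e5
    set b' := hv.erase T (α⁻¹ (hv.erase {y} a)) with hb'
    have hb'm : b' ∈ lcs N k := map_mem_lcs _ (map_mem_lcs (α⁻¹ : MulAut N).toMonoidHom
      (map_mem_lcs _ ha))
    refine ⟨b' * b, mul_mem hb'm hb, ?_⟩
    rw [commutatorElement_mul_left_of_commute (commute_of_mem_lcs hk
      (Subgroup.commutator_mem_commutator hb (Subgroup.mem_top _)) _), mul_assoc,
      Finset.coe_insert, hv.erase_insert, MonoidHom.comp_apply, ← e5, ← hbf]

/-- After everything except `v x₀` has been erased from `f (v x₀)`, what remains is a power of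
`v x₀` in the commutator subgroup, which is trivial. -/
theorem exists_commutator_eq [Infinite ι] (hk1 : 1 ≤ k) (hv : IsFreeNilpotentFamily (k + 2) v)
    (hf : IsTwist (k + 1) (v x₀) f σ) (hσ : NormalClosureInner k σ) :
    ∃ b ∈ lcs N k, f (v x₀) = ⁅b, v x₀⁆ := by
  classical
  obtain ⟨S, hS⟩ := hv.exists_finset_mem_closure (f (v x₀))
  obtain ⟨b, hb, h⟩ := hf.exists_commutator_mul_erase hv hσ (S.erase x₀) (by simp)
  refine ⟨b, hb, ?_⟩
  rw [hv.eq_one_of_mem_zpowers (i := x₀) (g := hv.erase _ (f (v x₀))) (by omega) ?_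
    (map_mem_lcs _ (lcs_antitone (by omega) (hf.mem _))), mul_one] at h
  · exact h
  · have : Subgroup.closure (v '' S) ≤
        (Subgroup.zpowers (v x₀)).comap (hv.erase (S.erase x₀ : Finset ι)) := by
      rw [Subgroup.closure_le]
      rintro _ ⟨i, hi, rfl⟩
      rw [SetLike.mem_coe, Subgroup.mem_comap]
      by_cases hix : i = x₀
      · rw [hv.erase_of_notMem (by simp [hix]), hix]
        exact Subgroup.mem_zpowers _
      · rw [hv.erase_of_mem (by simpa [hix] using hi)]
        exact one_mem _
    exact this hS

/-- If `f (v x₀) = 1`, then `f` commutes with the automorphisms that fix `v x₀`. -/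
theorem map_apply_of_map_eq (hk1 : 1 ≤ k) (hv : IsFreeNilpotentFamily (k + 2) v)
    (hf : IsTwist (k + 1) (v x₀) f σ) (hσ : NormalClosureInner k σ) (h1 : f (v x₀) = 1)
    {α : MulAut N} (hα : α (v x₀) = v x₀) (g : N) : f (α g) = α (f g) := by
  have hk := hv.lcs_eq_bot
  obtain ⟨a, ha, h⟩ := hf.exists_commutator_of_map_eq hk hσ hα
  have hx := h (v x₀)
  have hα' : α⁻¹ (v x₀) = v x₀ := by
    conv_lhs => rw [← hα]
    exact MulAut.inv_apply_self _ _ _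
  rw [hα', h1, map_one, one_mul, inv_one, eq_comm] at hx
  have hg := h (α g)
  rw [MulAut.inv_apply_self, commutatorElement_eq_one_iff_commute.2
    (commute_of_mem_lcs hk (hv.mem_lcs_succ_of_commutator_eq_one hk1 rfl ha hx) _),
    mul_inv_eq_one] at hg
  exact hg.symm

/-- If `f` commutes with the automorphisms that fix `v x₀`, then `f (v z)` is a word in `v x₀` and
`v z`: a further basis element in it could be exchanged for one that does not occur. -/
theorem erase_apply_eq [Infinite ι] {c : ℕ} (hv : IsFreeNilpotentFamily c v)
    (hα : ∀ α : MulAut N, α (v x₀) = v x₀ → ∀ g, f (α g) = α (f g))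
    {z : ι} (T : Finset ι) (hx : x₀ ∉ T) (hz : z ∉ T) :
    hv.erase T (f (v z)) = f (v z) := by
  classical
  obtain ⟨S, hS⟩ := hv.exists_finset_mem_closure (f (v z))
  induction T using Finset.induction_on with
  | empty => simp [hv.erase_empty]
  | insert y T hy ih =>
    rw [Finset.mem_insert, not_or] at hx hz
    obtain ⟨t, ht⟩ := Infinite.exists_notMem_finset (insert x₀ (insert z (insert y S)))
    simp only [Finset.mem_insert, not_or] at ht
    obtain ⟨α, h1, -⟩ := hv.exists_swap y t
    have e := hα α (by rw [h1, Equiv.swap_apply_of_ne_of_ne hx.1 (Ne.symm ht.1)]) (v z)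
    rw [h1, Equiv.swap_apply_of_ne_of_ne hz.1 (Ne.symm ht.2.1)] at e
    have e2 := erase_swap hv ht.2.2.1 ht.2.2.2 h1 hS
    rw [← e] at e2
    rw [Finset.coe_insert, hv.erase_insert, MonoidHom.comp_apply, e2, ih hx.2 hz.2]

/-- Since `f (v z)` is a word in `v x₀` and `v z`, homomorphisms that agree on these two elements
agree on `f (v z)`. -/
theorem hom_apply_eq [Infinite ι] {M : Type*} [Group M] {c : ℕ} (hv : IsFreeNilpotentFamily c v)
    (hα : ∀ α : MulAut N, α (v x₀) = v x₀ → ∀ g, f (α g) = α (f g))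
    {z : ι} {φ ψ : N →* M} (hx : φ (v x₀) = ψ (v x₀)) (hz : φ (v z) = ψ (v z)) :
    φ (f (v z)) = ψ (f (v z)) := by
  classical
  obtain ⟨S, hS⟩ := hv.exists_finset_mem_closure (f (v z))
  rw [← erase_apply_eq hv hα (S.filter fun i => i ≠ x₀ ∧ i ≠ z) (by simp) (by simp)]
  refine MonoidHom.eq_of_mem_closure_image (φ := φ.comp (hv.erase _)) (ψ := ψ.comp (hv.erase _)) hS
    fun i hi => ?_
  rw [MonoidHom.comp_apply, MonoidHom.comp_apply]
  by_cases h : i ≠ x₀ ∧ i ≠ z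
  · rw [hv.erase_of_mem (by simpa using ⟨hi, h⟩), map_one, map_one]
  · rw [hv.erase_of_notMem (by simpa using fun _ hix hiz => h ⟨hix, hiz⟩)]
    by_cases hix : i = x₀
    · rw [hix, hx]
    · have hiz : i = z := by
        by_contra hiz
        exact h ⟨hix, hiz⟩
      rw [hiz, hz]

/-- `f (v z)` is linear in `v z`, since `f` is additive along the transvection `v z ↦ v z * v t`. -/
theorem map_apply_eq_sq_of_map_eq_sq [Infinite ι] {c : ℕ} (hv : IsFreeNilpotentFamily c v)
    (hmul : ∀ g h, f (g * h) = f g * f h)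
    (hα : ∀ α : MulAut N, α (v x₀) = v x₀ → ∀ g, f (α g) = α (f g))
    {z : ι} (hzx : z ≠ x₀) {φ : N →* N} (hx : φ (v x₀) = v x₀) (hz : φ (v z) = v z ^ 2) :
    φ (f (v z)) = f (v z) ^ 2 := by
  classical
  obtain ⟨t, ht⟩ := Infinite.exists_notMem_finset {x₀, z}
  simp only [Finset.mem_insert, Finset.mem_singleton, not_or] at ht
  obtain ⟨α, hαz, hαi, -⟩ := hv.exists_transvection ht.2
  obtain ⟨s, hs, -⟩ := hv.exists_swap z t
  have hαx := hαi x₀ hzx.symm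
  have hsx : s (v x₀) = v x₀ := by
    rw [hs, Equiv.swap_apply_of_ne_of_ne hzx.symm (Ne.symm ht.1)]
  have hsz : s (v z) = v t := by rw [hs, Equiv.swap_apply_left]
  let ρ : N →* N := hv.extend hv.lcs_eq_bot fun i => if i = t then v z else v i
  have hρx : ρ (v x₀) = v x₀ := by simp [ρ, Ne.symm ht.1]
  have hρz : ρ (v z) = v z := by simp [ρ]
  have hρt : ρ (v t) = v z := by simp [ρ]
  have e := hα α hαx (v z)
  rw [hαz, hmul, ← hsz, hα s hsx] at e
  have e' := congrArg ρ e
  rw [_root_.map_mul] at e'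
  have e1 : ρ (f (v z)) = f (v z) :=
    hom_apply_eq hv hα (φ := ρ) (ψ := MonoidHom.id N) hρx hρz
  have e2 : ρ (s (f (v z))) = f (v z) :=
    hom_apply_eq hv hα (φ := ρ.comp s.toMonoidHom) (ψ := MonoidHom.id N)
      ((congrArg ρ hsx).trans hρx) ((congrArg ρ hsz).trans hρt)
  have e3 : ρ (α (f (v z))) = φ (f (v z)) := by
    refine hom_apply_eq hv hα (φ := ρ.comp α.toMonoidHom) (ψ := φ)
      ((congrArg ρ hαx).trans (hρx.trans hx.symm)) ((congrArg ρ hαz).trans ?_)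
    rw [_root_.map_mul, hρz, hρt, hz, sq]
  rw [← e3, ← e', e1, e2, sq]

/-- `f (v z)` is linear in `v x₀`: the conjugate of `σ` under the transvection
`v x₀ ↦ v x₀ * v t` is compared with the product of `σ` and its conjugate under the transposition
of `v x₀` and `v t`. -/
theorem map_apply_eq_sq_of_map_apply_eq_sq [Infinite ι] (hk1 : 1 ≤ k)
    (hv : IsFreeNilpotentFamily (k + 2) v)
    (hf : IsTwist (k + 1) (v x₀) f σ) (hσ : NormalClosureInner k σ)
    (hα : ∀ α : MulAut N, α (v x₀) = v x₀ → ∀ g, f (α g) = α (f g)) :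
    ∃ z, z ≠ x₀ ∧ ∀ φ : N →* N, φ (v x₀) = v x₀ ^ 2 → φ (v z) = v z →
      φ (f (v z)) = f (v z) ^ 2 := by
  classical
  have hk := hv.lcs_eq_bot
  obtain ⟨t, ht⟩ := Infinite.exists_notMem_finset {x₀}
  rw [Finset.mem_singleton] at ht
  obtain ⟨β, hβx, hβ, hβ'⟩ := hv.exists_transvection ht
  obtain ⟨s, hs, hs'⟩ := hv.exists_swap x₀ t
  have hsx : s (v x₀) = v t := by rw [hs, Equiv.swap_apply_left]
  have key := ((hf.conj β).mul ((hf.conj s).inv hk (by omega)) hk (by omega)).mul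
    (hf.inv hk (by omega)) hk (by omega)
  rw [hβx, hsx, mul_inv_cancel_right, mul_inv_cancel] at key
  obtain ⟨a, ha, haf⟩ := hσ _ (mul_mem (mul_mem (conj_mem_normalClosure β σ)
    (inv_mem (conj_mem_normalClosure s σ)))
    (inv_mem (Subgroup.subset_normalClosure (Set.mem_singleton σ)))) _ key
  obtain ⟨A, hA⟩ := hv.exists_finset_mem_closure a
  obtain ⟨z, hz⟩ := Infinite.exists_notMem_finset (insert x₀ (insert t A))
  simp only [Finset.mem_insert, not_or] at hz
  refine ⟨z, hz.1, fun φ hφx hφz => ?_⟩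
  have e := haf (v z)
  rw [hβ' z hz.1, hs', Equiv.swap_apply_of_ne_of_ne hz.1 hz.2.1] at e
  -- Sending every basis element except `v z` to `v x₀` kills `a`, as `a` does not involve `v z`.
  let ε : N →* N := hv.extend hv.lcs_eq_bot fun i => if i = z then v z else v x₀
  have hεz : ε (v z) = v z := by simp [ε]
  have hεi : ∀ i, i ≠ z → ε (v i) = v x₀ := fun i hi => by simp [ε, hi]
  have hεx := hεi x₀ (Ne.symm hz.1)
  have hεt := hεi t (Ne.symm hz.2.1)
  have hεa : ε a = 1 := by
    refine hv.eq_one_of_mem_zpowers (i := x₀) (by omega) ?_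
      (map_mem_lcs ε (lcs_antitone hk1 ha))
    have : Subgroup.closure (v '' A) ≤ (Subgroup.zpowers (v x₀)).comap ε := by
      rw [Subgroup.closure_le]
      rintro _ ⟨i, hi, rfl⟩
      rw [SetLike.mem_coe, Subgroup.mem_comap, hεi i (by rintro rfl; exact hz.2.2 hi)]
      exact Subgroup.mem_zpowers _
    exact this hA
  have e' := congrArg ε e
  rw [map_commutatorElement, hεa, commutatorElement_one_left, _root_.map_mul, _root_.map_mul,
    _root_.map_inv, _root_.map_inv] at e'
  have e1 : ε (f (v z)) = f (v z) :=
    hom_apply_eq hv hα (φ := ε) (ψ := MonoidHom.id N) hεx hεz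
  have e2 : ε (s (f (v z))) = f (v z) :=
    hom_apply_eq hv hα (φ := ε.comp s.toMonoidHom) (ψ := MonoidHom.id N)
      ((congrArg ε hsx).trans hεt) (by
        change ε (s (v z)) = v z
        rw [hs, Equiv.swap_apply_of_ne_of_ne hz.1 hz.2.1, hεz])
  have e3 : ε (β (f (v z))) = φ (f (v z)) := by
    refine hom_apply_eq hv hα (φ := ε.comp β.toMonoidHom) (ψ := φ)
      ((congrArg ε hβx).trans ?_) ((congrArg ε (hβ z hz.1)).trans (hεz.trans hφz.symm))
    rw [_root_.map_mul, hεx, hεt, hφx, sq]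
  rw [e1, e2, e3, mul_inv_eq_one, mul_inv_eq_iff_eq_mul] at e'
  rw [e', sq]

theorem _root_.IsFreeNilpotentFamily.pow_inv_mul_map_mem_lcs_one {c : ℕ}
    (hv : IsFreeNilpotentFamily c v) {n : ℕ} {e : N →* N} (he : ∀ i, e (v i) = v i ^ n) (g : N) :
    (g ^ n)⁻¹ * e g ∈ lcs N 1 := by
  have h : (powMonoidHom n).comp Abelianization.of = Abelianization.of.comp e :=
    hv.hom_ext fun i => by simp [he]
  have hg := DFunLike.congr_fun h g
  rw [MonoidHom.comp_apply, MonoidHom.comp_apply, powMonoidHom_apply, ← map_pow] at hg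
  exact QuotientGroup.eq.1 hg

/-- `f (v z)` is linear in both `v x₀` and `v z`, but has degree `k + 2 > 2`, so it is trivial. -/
theorem eq_one_of_map_eq_one [Infinite ι] (hk1 : 1 ≤ k) (hv : IsFreeNilpotentFamily (k + 2) v)
    (hf : IsTwist (k + 1) (v x₀) f σ) (hσ : NormalClosureInner k σ) (h1 : f (v x₀) = 1) (g : N) :
    f g = 1 := by
  classical
  have hα : ∀ α : MulAut N, α (v x₀) = v x₀ → ∀ g, f (α g) = α (f g) := fun α hx g =>
    hf.map_apply_of_map_eq hk1 hv hσ h1 hx g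
  obtain ⟨z, hzx, hz⟩ := hf.map_apply_eq_sq_of_map_apply_eq_sq hk1 hv hσ hα
  let Δ : N →* N := hv.extend hv.lcs_eq_bot fun i => v i ^ 2
  let φ : N →* N := hv.extend hv.lcs_eq_bot (Function.update v x₀ (v x₀ ^ 2))
  let ψ : N →* N := hv.extend hv.lcs_eq_bot (Function.update v z (v z ^ 2))
  have hφx : φ (v x₀) = v x₀ ^ 2 := by simp [φ]
  have hφz : φ (v z) = v z := by simp [φ, hzx]
  have hψx : ψ (v x₀) = v x₀ := by simp [ψ, hzx.symm]
  have hψz : ψ (v z) = v z ^ 2 := by simp [ψ]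
  have e1 : Δ (f (v z)) = f (v z) ^ 4 := by
    have := hom_apply_eq hv hα (φ := Δ) (ψ := φ.comp ψ) (z := z)
      (by simp [Δ, hψx, hφx]) (by simp [Δ, hψz, hφz])
    rw [this, MonoidHom.comp_apply, map_apply_eq_sq_of_map_eq_sq hv hf.map_mul hα hzx hψx hψz,
      map_pow, hz φ hφx hφz, ← pow_mul]
  -- On the last term of the series, `Δ` is the power with exponent `2 ^ (k + 2)`.
  have e2 := pow_inv_mul_map_mem_lcs
    (hv.pow_inv_mul_map_mem_lcs_one (e := Δ) fun i => hv.extend_apply _ _ i) (hf.mem (v z))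
  rw [hv.lcs_eq_bot, Subgroup.mem_bot, inv_mul_eq_one, e1] at e2
  have h8 : 4 < 2 ^ (k + 1 + 1) :=
    calc 4 < 2 ^ 3 := by norm_num
      _ ≤ 2 ^ (k + 1 + 1) := Nat.pow_le_pow_right (by norm_num) (by omega)
  have e3 : f (v z) = 1 := by
    refine hv.eq_one_of_pow_eq_one (n := 2 ^ (k + 1 + 1) - 4) (by omega) rfl (hf.mem _) ?_
    rw [pow_sub _ h8.le, e2, mul_inv_cancel]
  have e4 : hf.hom = 1 := by
    refine hv.hom_ext fun i => ?_
    rw [hom_apply, MonoidHom.one_apply]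
    by_cases hi : i = x₀
    · rw [hi, h1]
    · obtain ⟨s, hs, -⟩ := hv.exists_swap z i
      have e := hα s (by rw [hs, Equiv.swap_apply_of_ne_of_ne hzx.symm (Ne.symm hi)]) (v z)
      rwa [hs, Equiv.swap_apply_left, e3, map_one] at e
  exact DFunLike.congr_fun e4 g

/-- An automorphism that is conjugation by a basis element modulo the last term of the series and
satisfies `NormalClosureInner` is conjugation by a basis element. -/
theorem exists_eq_conj [Infinite ι] (hk1 : 1 ≤ k) (hv : IsFreeNilpotentFamily (k + 2) v)
    (hf : IsTwist (k + 1) (v x₀) f σ) (hσ : NormalClosureInner k σ) :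
    ∃ x, IsPrimitiveElement (k + 2) x ∧ σ = MulAut.conj x := by
  classical
  have hk := hv.lcs_eq_bot
  obtain ⟨b, hb, h⟩ := hf.exists_commutator_eq hk1 hv hσ
  -- Replacing `v x₀` by `v x₀ * b` makes the twist trivial on the new basis element.
  let w := Function.update v x₀ (v x₀ * b)
  have hwx : w x₀ = v x₀ * b := by simp [w]
  have hw : IsFreeNilpotentFamily (k + 2) w := hv.of_congr fun i => by
    by_cases hi : i = x₀
    · simpa [w, hi] using lcs_antitone hk1 hb
    · simp [w, hi, one_mem]
  have hf' := hf.absorb hk hb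
  rw [← hwx] at hf'
  have h1 : f (w x₀) * ⁅b, w x₀⁆⁻¹ = 1 := by
    rw [hwx, hf.map_mul, hf.map_eq_one_of_mem hk (lcs_antitone hk1 hb), mul_one, h,
      commutatorElement_mul_right_eq_mul_conj, commutatorElement_self,
      mul_one, mul_inv_cancel_right, mul_inv_cancel]
  refine ⟨w x₀, hw.isPrimitiveElement (by omega) x₀, MulEquiv.ext fun g => ?_⟩
  rw [hf'.apply, hf'.eq_one_of_map_eq_one hk1 hw hσ h1, mul_one, MulAut.conj_apply]

end IsTwist

/-! ### Conjugations by primitive elements -/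

theorem mem_IASubgroup_iff {N : Type*} [Group N] {k : ℕ} {τ : MulAut N} :
    τ ∈ IASubgroup N (k + 1) ↔ ∀ g, g⁻¹ * τ g ∈ lcs N (k + 1) := by
  refine ⟨fun h g => ?_, fun h => MulEquiv.ext fun q => ?_⟩
  · exact QuotientGroup.eq.1 (DFunLike.congr_fun h (g : N ⧸ lcs N (k + 1))).symm
  · induction q using QuotientGroup.induction_on with
    | H g => exact (QuotientGroup.eq.2 (h g)).symm

theorem gammaTerm_innSubgroup (N : Type*) [Group N] (k : ℕ) :
    gammaTerm (innSubgroup N) (k + 1) = (lcs N k).map MulAut.conj := by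
  rw [lcs, Subgroup.map_lowerCentralSeries, innSubgroup, MonoidHom.range_eq_map]
  rfl

theorem innSubgroup_normal (N : Type*) [Group N] : (innSubgroup N).Normal where
  conj_mem := by
    rintro _ ⟨a, rfl⟩ τ
    exact ⟨τ a, MulEquiv.ext fun g => by simp⟩

theorem IsTwist.of_forall_mem {N : Type*} [Group N] {k : ℕ} (hk : lcs N (k + 1) = ⊥) {x : N}
    {σ : MulAut N} (h : ∀ g, (x * g * x⁻¹)⁻¹ * σ g ∈ lcs N k) :
    IsTwist k x (fun g => (x * g * x⁻¹)⁻¹ * σ g) σ where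
  mem := h
  map_mul a b := by
    have e := (commute_of_mem_lcs hk (h a) (x * b * x⁻¹)⁻¹).eq
    rw [_root_.map_mul, ← mul_assoc _ (x * b * x⁻¹)⁻¹ (σ b), e]
    group
  apply g := by rw [mul_inv_cancel_left]

theorem normalClosureInner_of_le {N : Type*} [Group N] {k : ℕ} (hk : lcs N (k + 2) = ⊥)
    {σ : MulAut N} (h : Subgroup.normalClosure {σ} ⊓ IASubgroup N (k + 1) ≤
      gammaTerm (innSubgroup N) (k + 1)) : NormalClosureInner k σ := by
  intro τ hτ h' ht
  have e : ∀ g, τ g = g * h' g := fun g => by simpa using ht.apply g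
  have h1 := h ⟨hτ, mem_IASubgroup_iff.2 fun g => by
    rw [e, inv_mul_cancel_left]
    exact ht.mem g⟩
  rw [gammaTerm_innSubgroup] at h1
  obtain ⟨a, ha, rfl⟩ := h1
  refine ⟨a, ha, fun g => ?_⟩
  have e' := e g
  rw [← (commute_of_mem_lcs hk (ht.mem g) g).eq, MulAut.conj_apply] at e'
  rw [commutatorElement_def, e', mul_inv_cancel_right]

theorem mainTheorem9 {N : Type*} [Group N] (c : ℕ) (hc : 3 ≤ c)
    (hN : IsFreeNilpotent c N) (hinf : ¬ Group.FG N) (σ : MulAut N) :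
    (∃ x : N, IsPrimitiveElement c x ∧ σ = MulAut.conj x) ↔
      (∃ y : N ⧸ gammaTerm (⊤ : Subgroup N) c, IsPrimitiveElement (c - 1) y ∧
          autQuotient (gammaTerm (⊤ : Subgroup N) c) σ = MulAut.conj y) ∧
        Subgroup.normalClosure {σ} ⊓ IASubgroup N (c - 1) ≤
          gammaTerm (innSubgroup N) (c - 1) := by
  obtain ⟨k, rfl⟩ : ∃ k, c = k + 2 := ⟨c - 2, by omega⟩
  constructor
  · rintro ⟨x, ⟨X, hX, hx⟩, rfl⟩
    rw [isFreeNilpotentBasis_iff] at hX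
    have := hX.infinite hinf
    refine ⟨⟨(x : N ⧸ lcs N (k + 1)), ?_, ?_⟩, ?_⟩
    · exact (hX.quotient (d := k + 1) (by omega)).isPrimitiveElement (by omega) ⟨x, hx⟩
    · refine MulEquiv.ext fun q => ?_
      induction q using QuotientGroup.induction_on with
      | H g => rfl
    · change _ ⊓ IASubgroup N (k + 1) ≤ gammaTerm (innSubgroup N) (k + 1)
      rintro τ ⟨hτ, hIA⟩
      have hn : (innSubgroup N).Normal := innSubgroup_normal N
      obtain ⟨a, rfl⟩ := Subgroup.normalClosure_le_normal
        (N := innSubgroup N)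
        (Set.singleton_subset_iff.2 ⟨x, rfl⟩) hτ
      rw [gammaTerm_innSubgroup]
      refine ⟨a, hX.mem_lcs_of_forall_commutator (by omega) fun z => ?_, rfl⟩
      have h1 := mem_IASubgroup_iff.1 hIA z
      have h2 := (inferInstance : (lcs N (k + 1)).Normal).conj_mem _ h1 z
      rwa [MulAut.conj_apply, mul_inv_cancel_left] at h2
  · rintro ⟨⟨y, ⟨Y, hY, hy⟩, hσy⟩, hNC⟩
    obtain ⟨X, hX⟩ := hN
    rw [isFreeNilpotentBasis_iff] at hX hY
    have hv : IsFreeNilpotentFamily (k + 2) fun i : Y => Quotient.out i.1 :=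
      hX.of_quotient (d := k + 1) (by omega) (by
        have e : (fun i : Y => ((Quotient.out i.1 : N) : N ⧸ lcs N (k + 1))) =
            fun i : Y => i.1 := funext fun i => QuotientGroup.out_eq' _
        rw [e]
        exact hY)
    have := hv.infinite hinf
    have hk := hv.lcs_eq_bot
    refine (IsTwist.of_forall_mem (k := k + 1) hk (x := Quotient.out y) fun g => ?_).exists_eq_conj
      (x₀ := ⟨y, hy⟩) (by omega) hv (normalClosureInner_of_le hk hNC)
    have h1 := DFunLike.congr_fun hσy (g : N ⧸ lcs N (k + 1))
    refine QuotientGroup.eq.1 (Eq.trans ?_ h1.symm)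
    have e : ((Quotient.out y : N) : N ⧸ lcs N (k + 1)) = y := QuotientGroup.out_eq' y
    exact congrArg (fun q : N ⧸ lcs N (k + 1) => q * g * q⁻¹) e
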